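/- For a unital $C^*$-algebra $A$ and $k\ge 1$, let $A_{\mathrm{sa}}$ be the set of self-adjoint elements of $A$ and equip $A^k$ with the norm $\|(a_1,\dots,a_k)\|=\max_i\|a_i\|$. The generator rank $\mathrm{gr}(A)$ is the smallest integer $k\ge 0$ such that the set of tuples $(a_0,\dots,a_k)\in (A_{\mathrm{sa}})^{k+1}$ that generate $A$ as a $C^*$-algebra is dense in $(A_{\mathrm{sa}})^{k+1}$, and $\mathrm{gr}(A)=\infty$ if there is no such $k$. The real rank of $A$ is the smallest integer $k\ge 0$ such that the set of tuples $(a_0,\dots,a_k)\in (A_{\mathrm{sa}})^{k+1}$ for which $\sum_i a_i^*a_i$ is invertible is dense in $(A_{\mathrm{sa}})^{k+1}$, and $\infty$ if there is no such $k$. The stable rank of $A$ is the smallest integer $k\ge 1$ such that the set of tuples $(a_1,\dots,a_k)\in A^k$ for which $\sum_i a_i^*a_i$ is invertible is dense in $A^k$, and $\infty$ if there is no such $k$. Write $M_n=M_n(\mathbb{C})$, so that $A\otimes M_n$ is the $C^*$-algebra of $n\times n$ matrices over $A$. **Theorem.** Let $A$ be a unital $C^*$-algebra with real rank zero and stable rank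 one, and let $n\ge 1$ be an integer. If $\mathrm{gr}(A)\ge 1$, then $$\mathrm{gr}(A\otimes M_n)\le\left\lceil\frac{\mathrm{gr}(A)}{n^2}\right\rceil,$$ where the right-hand side is read as $\infty$ if $\mathrm{gr}(A)=\infty$. In particular, if $\mathrm{gr}(A)\le n^2$, then $\mathrm{gr}(A\otimes M_n)\le 1$. -/

import Mathlib

open scoped ENNReal

noncomputable section

namespace CStarRank

/-- `C*(a)`: the (not necessarily unital) C*-subalgebra of `A` generated by the entries of a
tuple `a`, that is, the norm closure of the non-unital star subalgebra they generate. -/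
def generatedSubalgebra {A : Type*} [CStarAlgebra A] {k : ℕ} (a : Fin k → A) :
    NonUnitalStarSubalgebra ℂ A :=
  (NonUnitalStarAlgebra.adjoin ℂ (Set.range a)).topologicalClosure

/-- `Gen_k(A)_sa`: the self-adjoint `k`-tuples that generate `A` as a C*-algebra, as a subset of
`(A_sa)^k` (with the product topology, which is the topology of the maximum norm). -/
def genSA (A : Type*) [CStarAlgebra A] (k : ℕ) : Set (Fin k → selfAdjoint A) :=
  {a | generatedSubalgebra (fun i => (a i : A)) = ⊤}

/-- `Lg_k(A)`: the `k`-tuples `a` for which `∑ i, (a i)* (a i)` is invertible. -/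
def lg (A : Type*) [CStarAlgebra A] (k : ℕ) : Set (Fin k → A) :=
  {a | IsUnit (∑ i, star (a i) * a i)}

/-- `Lg_k(A)_sa`: the self-adjoint `k`-tuples in `Lg_k(A)`, as a subset of `(A_sa)^k`. -/
def lgSA (A : Type*) [CStarAlgebra A] (k : ℕ) : Set (Fin k → selfAdjoint A) :=
  {a | (fun i => (a i : A)) ∈ lg A k}

/-- The generator rank of a unital C*-algebra: the smallest `k ≥ 0` such that `Gen_{k+1}(A)_sa`
is dense in `(A_sa)^{k+1}`, and `∞` if there is no such `k`. -/
def generatorRank (A : Type*) [CStarAlgebra A] : ℕ∞ :=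
  ⨅ (k : ℕ) (_ : Dense (genSA A (k + 1))), (k : ℕ∞)

/-- The real rank of a unital C*-algebra: the smallest `k ≥ 0` such that `Lg_{k+1}(A)_sa`
is dense in `(A_sa)^{k+1}`, and `∞` if there is no such `k`. -/
def realRank (A : Type*) [CStarAlgebra A] : ℕ∞ :=
  ⨅ (k : ℕ) (_ : Dense (lgSA A (k + 1))), (k : ℕ∞)

/-- The (topological) stable rank of a unital C*-algebra: the smallest `k ≥ 1` such that
`Lg_k(A)` is dense in `A^k`, and `∞` if there is no such `k`. -/
def stableRank (A : Type*) [CStarAlgebra A] : ℕ∞ :=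
  ⨅ (k : ℕ) (_ : 1 ≤ k) (_ : Dense (lg A k)), (k : ℕ∞)

end CStarRank

end

namespace CStarRank

open Filter Topology

section Closure

/-! The proof is a count of self-adjoint parameters. Write `l` for the ceiling. A tuple of `l + 1`
self-adjoint `n × n` matrices can be put, after unitary conjugation and small perturbation, into a
normal form: the first matrix is diagonal with entries of pairwise disjoint spectra avoiding zero,
and the second has positive invertible entries in its first row off the diagonal. The diagonal costs
`n` parameters, the other `l` matrices cost `l * n ^ 2`, and positivity of the row saves `n - 1`.
This leaves `l * n ^ 2 + 1` parameters, exactly enough to perturb them to generators of `A` when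
`gr(A) ≤ l * n ^ 2` (`dense_generating`).

Such a perturbed normal form generates the matrix algebra. Functional calculus on the first matrix
yields the diagonal matrix units (`map_single_mem`), the positive row yields the remaining ones, and
then all parameters appear in a corner (`eq_top_of_entries`, `param_mem`). The conditions on spectra
are open, so they survive the perturbation.

Real rank zero separates the spectra (`dense_separatedSpectra`) and diagonalizes the first matrix
approximately. For the latter, a self-adjoint element is approximated by an invertible `L * d * star
L` with `d` diagonal (`CongruenceDense`). By a form of Sylvester's law of inertia, its sign is
unitarily conjugate to the sign of `d` (`exists_unitary_conj_signElem`). Subtracting a multiple of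
the sign shrinks the norm, and the remainder commutes with a diagonal projection, so the process
iterates (`exists_unitary_norm_conj_sub_le`). Stable rank one makes the row entries invertible, and
a diagonal unitary then turns them into positive elements by polar decomposition. -/

theorem mem_closure_of_continuousAt {X Y : Type*} [TopologicalSpace X] [TopologicalSpace Y]
    {f : X → Y} {x : X} {s : Set X} {t : Set Y} (hf : ContinuousAt f x) (hx : x ∈ closure s)
    (h : ∀ᶠ w in 𝓝 x, w ∈ s → f w ∈ t) : f x ∈ closure t := by
  rw [mem_closure_iff_frequently] at hx ⊢
  exact hf.tendsto.frequently ((hx.and_eventually h).mono fun w hw => hw.2 hw.1)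

end Closure

/-! ### Block elimination relative to an idempotent -/

section Ring

variable {R : Type*} [Ring R]

/-- The Schur complement computation: conjugating by a unipotent element removes the off-diagonal
part of `w` with respect to an idempotent `q`. -/
theorem schur_offDiag_eq_zero {q w I : R} (hq : q * q = q)
    (hqI : q * I = I * q) (hI : I * (q + (1 - q) * w * (1 - q)) = 1) :
    q * ((1 - q * w * (1 - q) * I) * w * (1 - I * (1 - q) * w * q)) * (1 - q) = 0 := by
  have hqr : q * (1 - q) = 0 := by rw [mul_sub, hq, mul_one, sub_self]
  have hrr : (1 - q) * (1 - q) = 1 - q := by rw [mul_sub, sub_mul, sub_mul, hq]; simp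
  have h1 : (1 - I * (1 - q) * w * q) * (1 - q) = 1 - q := by
    rw [sub_mul, mul_assoc _ q, hqr]; simp
  have h2 : q * (1 - q * w * (1 - q) * I) = q - q * w * (1 - q) * I := by
    rw [mul_sub]; simp only [← mul_assoc, hq, mul_one]
  have hrI : (1 - q) * I = I * (1 - q) := by rw [sub_mul, mul_sub, hqI]; simp
  have h3 : (1 - q) * I * (w * (1 - q)) = 1 - q := by
    have := congrArg (fun z => z * (1 - q)) hI
    simp only [mul_add, add_mul, one_mul] at this
    rw [mul_assoc I q, hqr, mul_zero, zero_add, mul_assoc, mul_assoc _ (1 - q) (1 - q), hrr,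
      mul_assoc (1 - q) w, ← mul_assoc, ← hrI] at this
    exact this
  calc _ = (q * (1 - q * w * (1 - q) * I)) * w * ((1 - I * (1 - q) * w * q) * (1 - q)) := by
        simp only [mul_assoc]
    _ = q * w * (1 - q) - q * w * ((1 - q) * I * (w * (1 - q))) := by
        rw [h1, h2]; simp only [sub_mul, mul_assoc]
    _ = 0 := by rw [h3, sub_self]

theorem isUnit_one_sub_of_mul_self_eq_zero {x : R} (h : x * x = 0) : IsUnit (1 - x) := by
  refine ⟨⟨1 - x, 1 + x, ?_, ?_⟩, rfl⟩ <;> simp [mul_add, add_mul, sub_mul, mul_sub, h]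

/-- The `L D L*` factorization of an element whose compression to one corner is invertible. -/
theorem unipotent_mul_mul_unipotent {y z J c : R} (hJc : J * c = 1) (hcJ : c * J = 1)
    (hy : y * J * y = 0) (hz : z * J * z = 0) :
    (1 + y * J) * (c - y * J * z) * (1 + J * z) = c + y + z := by
  have h1 : (1 + y * J) * (c - y * J * z) = c + y - y * J * z := by
    rw [add_mul, one_mul, mul_sub (y * J), mul_assoc y J c, hJc, ← mul_assoc (y * J), ← mul_assoc (y * J),
      hy]
    simp; abel
  rw [h1, mul_add, mul_one, sub_mul, add_mul, ← mul_assoc c, hcJ,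
    show y * J * z * (J * z) = y * J * (z * J * z) by simp only [mul_assoc], hz]
  simp only [one_mul, mul_zero, mul_assoc]; abel

end Ring

/-! ### Commutants of projections and approximation up to congruence -/

variable {B : Type*} [CStarAlgebra B]

theorem inverse_mem_of_isClosed {S : StarSubalgebra ℂ B} [hS : IsClosed (S : Set B)] {x : B}
    (hx : x ∈ S) : Ring.inverse x ∈ S := by
  by_cases hu : IsUnit x
  · obtain ⟨v, hv⟩ := (StarSubalgebra.coe_isUnit (S := S) (a := ⟨x, hx⟩)).1 hu
    have h1 : x * (v⁻¹ : Sˣ).1.1 = 1 := by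
      have := congrArg (Subtype.val) v.mul_inv
      rw [hv] at this
      simpa using this
    have : Ring.inverse x = (v⁻¹ : Sˣ).1.1 := by
      rw [← mul_one (Ring.inverse x), ← h1, ← mul_assoc, Ring.inverse_mul_cancel _ hu, one_mul]
    rw [this]
    exact (v⁻¹ : Sˣ).1.2
  · rw [Ring.inverse_non_unit _ hu]; exact zero_mem S

theorem isClosed_inf_centralizer (S : StarSubalgebra ℂ B) [hS : IsClosed (S : Set B)]
    (Z : Set B) : IsClosed ((S ⊓ StarSubalgebra.centralizer ℂ Z : StarSubalgebra ℂ B) : Set B) := by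
  rw [StarSubalgebra.coe_inf, StarSubalgebra.coe_centralizer]
  exact hS.inter (Set.isClosed_centralizer _)

theorem mem_centralizer_singleton {e x : B} (he : IsSelfAdjoint e) :
    x ∈ StarSubalgebra.centralizer ℂ {e} ↔ e * x = x * e := by
  simp [StarSubalgebra.mem_centralizer_iff, he.star_eq]

/-- The invertible self-adjoint elements of `S` are dense among its self-adjoint elements. -/
def SelfAdjointUnitsDense (S : StarSubalgebra ℂ B) : Prop :=
  ∀ x ∈ S, IsSelfAdjoint x → x ∈ closure {y | y ∈ S ∧ IsSelfAdjoint y ∧ IsUnit y}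

theorem inverse_isSelfAdjoint {x : B} (hx : IsSelfAdjoint x) : IsSelfAdjoint (Ring.inverse x) := by
  rw [isSelfAdjoint_iff, ← Ring.inverse_star, hx.star_eq]

theorem inverse_commute {x q : B} (h : q * x = x * q) :
    q * Ring.inverse x = Ring.inverse x * q := by
  by_cases hu : IsUnit x
  · obtain ⟨v, rfl⟩ := hu
    rw [Ring.inverse_unit]
    exact (show Commute q (v : B) from h).units_inv_right
  · rw [Ring.inverse_non_unit _ hu, mul_zero, zero_mul]

/-- The `1 - q` corner of the given element is the identity of that corner, so nearby units still
have an invertible `1 - q` corner. A unipotent congruence then clears their off-diagonal blocks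
without losing invertibility or self-adjointness. -/
theorem SelfAdjointUnitsDense.mem_closure_corner {S : StarSubalgebra ℂ B}
    [hS : IsClosed (S : Set B)] (h : SelfAdjointUnitsDense S) {q : B} (hq : IsStarProjection q)
    (hqS : q ∈ S) {x : B} (hxS : x ∈ S) (hx : IsSelfAdjoint x) (hqx : q * x = x * q) :
    x * q + (1 - q) ∈ closure {y | y ∈ S ⊓ StarSubalgebra.centralizer ℂ {q} ∧
      IsSelfAdjoint y ∧ IsUnit y} := by
  have hqq : q * q = q := hq.isIdempotentElem
  have hqs : star q = q := hq.isSelfAdjoint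
  have hqr : q * (1 - q) = 0 := by rw [mul_sub, hqq, mul_one, sub_self]
  have hrq : (1 - q) * q = 0 := by rw [sub_mul, hqq, one_mul, sub_self]
  have hrr : (1 - q) * (1 - q) = 1 - q := by rw [mul_sub, hrq]; simp
  have hrs : star (1 - q) = 1 - q := by rw [star_sub, hqs, star_one]
  have hrS : 1 - q ∈ S := sub_mem (one_mem S) hqS
  set z := x * q + (1 - q) with hz
  have hzS : z ∈ S := add_mem (mul_mem hxS hqS) hrS
  have hzsa : IsSelfAdjoint z := by
    rw [isSelfAdjoint_iff, hz, star_add, star_mul, hqs, hx.star_eq, hrs, hqx]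
  -- `m w` completes the `1 - q` corner of `w` by `q`, so inverting it inverts the corner. For
  -- self-adjoint `w`, `G w` is the congruence of `w` by `L w`. Since `m z = 1`, `G` is continuous
  -- at `z`, and it fixes `z`.
  let m : B → B := fun w => q + (1 - q) * w * (1 - q)
  let L : B → B := fun w => 1 - q * w * (1 - q) * Ring.inverse (m w)
  let G : B → B := fun w => L w * w * (1 - Ring.inverse (m w) * (1 - q) * w * q)
  have hmz : m z = 1 := by
    simp only [m, hz]
    rw [mul_add, add_mul, hrr, hrr, mul_assoc, mul_assoc, hqr]; simp
  have hqzr : q * z * (1 - q) = 0 := by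
    rw [hz, mul_add, hqr, add_zero, mul_assoc, mul_assoc, hqr]; simp
  have hrzq : (1 - q) * z * q = 0 := by
    rw [hz, mul_add, add_mul, mul_assoc (1 - q) (1 - q), hrq, ← hqx, ← mul_assoc, hrq]; simp
  have hGz : G z = z := by
    simp only [G, L, hmz, hqzr, Ring.inverse_one, one_mul, hrzq]; simp
  have hmc : Continuous m := by fun_prop
  have hIc : ContinuousAt (fun w => Ring.inverse (m w)) z := by
    have h1 : ContinuousAt Ring.inverse (m z) := by
      rw [hmz]; exact NormedRing.inverse_continuousAt (1 : Bˣ)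
    exact ContinuousAt.comp h1 hmc.continuousAt
  have hGc : ContinuousAt G z := by fun_prop
  have hmu : ∀ᶠ w in 𝓝 z, IsUnit (m w) := by
    have : {y : B | IsUnit y} ∈ 𝓝 (m z) := Units.isOpen.mem_nhds (by rw [hmz]; exact isUnit_one)
    exact hmc.continuousAt.tendsto this
  rw [← hGz]
  refine mem_closure_of_continuousAt hGc (h z hzS hzsa) (hmu.mono ?_)
  rintro w hw ⟨hwS, hwsa, hwu⟩
  have hmsa : IsSelfAdjoint (m w) := by
    simp only [isSelfAdjoint_iff, m, star_add, star_mul, hqs, hrs, hwsa.star_eq, mul_assoc]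
  have hqm : q * m w = m w * q := by
    simp only [m, mul_add, add_mul, ← mul_assoc, hqr]
    simp only [mul_assoc, hrq]; simp
  have hmS : m w ∈ S := add_mem hqS (mul_mem (mul_mem hrS hwS) hrS)
  have hIS := inverse_mem_of_isClosed hmS
  set I := Ring.inverse (m w) with hI
  have hIsa : star I = I := inverse_isSelfAdjoint hmsa
  have hqI : q * I = I * q := inverse_commute hqm
  have hLstar : star (L w) = 1 - I * (1 - q) * w * q := by
    simp only [L, star_sub, star_one, star_mul, hqs, hrs, hwsa.star_eq, ← hI, hIsa, mul_assoc]
  have hGeq : G w = L w * w * star (L w) := by rw [hLstar]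
  have hLS : L w ∈ S := sub_mem (one_mem S) (mul_mem (mul_mem (mul_mem hqS hwS) hrS) hIS)
  have hGsa : IsSelfAdjoint (G w) := by
    rw [hGeq]; simp only [isSelfAdjoint_iff, star_mul, star_star, hwsa.star_eq, mul_assoc]
  have hLu : IsUnit (L w) := by
    apply isUnit_one_sub_of_mul_self_eq_zero
    have hrI : (1 - q) * I = I * (1 - q) := by rw [sub_mul, mul_sub, hqI]; simp
    calc _ = q * w * ((1 - q) * I * q) * w * (1 - q) * I := by simp only [← hI, mul_assoc]
      _ = 0 := by rw [hrI, mul_assoc I, hrq]; simp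
  have hoff : q * G w * (1 - q) = 0 :=
    schur_offDiag_eq_zero hqq hqI (Ring.inverse_mul_cancel _ hw)
  have hqG : q * G w = G w * q := by
    have h1 : q * G w = q * G w * q := by
      rw [mul_sub, mul_one, sub_eq_zero] at hoff; exact hoff
    have h2 := congrArg star h1
    simp only [star_mul, hqs, hGsa.star_eq] at h2
    rw [h1, h2, mul_assoc]
  refine ⟨⟨?_, (mem_centralizer_singleton hqs).2 hqG⟩, hGsa, ?_⟩
  · change G w ∈ S
    rw [hGeq]; exact mul_mem (mul_mem hLS hwS) (star_mem hLS)
  · rw [hGeq]; exact (hLu.mul hwu).mul hLu.star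

/-- Real rank zero passes to the commutant of a projection. -/
theorem SelfAdjointUnitsDense.inf_centralizer {S : StarSubalgebra ℂ B} [IsClosed (S : Set B)]
    (h : SelfAdjointUnitsDense S) {q : B} (hq : IsStarProjection q) (hqS : q ∈ S) :
    SelfAdjointUnitsDense (S ⊓ StarSubalgebra.centralizer ℂ {q}) := by
  rintro x ⟨hxS, hxq⟩ hx
  have hqq : q * q = q := hq.isIdempotentElem
  have hqs : star q = q := hq.isSelfAdjoint
  replace hxq := (mem_centralizer_singleton hqs).1 hxq
  have hr : IsStarProjection (1 - q) := hq.one_sub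
  have hrs : star (1 - q) = 1 - q := hr.isSelfAdjoint
  have h1 := h.mem_closure_corner hq hqS hxS hx hxq
  have h2 := h.mem_closure_corner hr (sub_mem (one_mem S) hqS) hxS hx
    (by rw [sub_mul, mul_sub, hxq]; simp)
  have hc : StarSubalgebra.centralizer ℂ {1 - q} = StarSubalgebra.centralizer ℂ {q} := by
    ext y
    rw [mem_centralizer_singleton hrs, mem_centralizer_singleton hqs, sub_mul, mul_sub]
    simp
  rw [hc, sub_sub_cancel] at h2
  -- Each corner is perturbed separately, and the two results are glued.
  have hx' : x = (x * q + (1 - q)) * q + (x * (1 - q) + q) * (1 - q) := by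
    simp only [add_mul, sub_mul, mul_sub, mul_one, one_mul, mul_assoc, hqq]; abel
  rw [hx']
  refine map_mem_closure₂ (f := fun a b => a * q + b * (1 - q)) (by fun_prop) h1 h2 ?_
  rintro y ⟨⟨hyS, hyq⟩, hy, hyu⟩ y' ⟨⟨hyS', hyq'⟩, hy', hyu'⟩
  replace hyq := (mem_centralizer_singleton hqs).1 hyq
  replace hyq' := (mem_centralizer_singleton hqs).1 hyq'
  have hyr' : (1 - q) * y' = y' * (1 - q) := by rw [sub_mul, mul_sub, hyq']; simp
  have hrr : (1 - q) * (1 - q) = 1 - q := hr.isIdempotentElem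
  have hqr : q * (1 - q) = 0 := by rw [mul_sub, hqq, mul_one, sub_self]
  have hrq : (1 - q) * q = 0 := by rw [sub_mul, hqq, one_mul, sub_self]
  have key : ∀ {a b c d : B}, q * c = c * q → (1 - q) * d = d * (1 - q) → a * c = 1 → b * d = 1 →
      (a * q + b * (1 - q)) * (c * q + d * (1 - q)) = 1 := by
    intro a b c d hc hd hac hbd
    rw [← hc, ← hd, mul_add, add_mul, add_mul]
    have e1 : a * q * (q * c) = q := by
      rw [mul_assoc, ← mul_assoc q, hqq, hc, ← mul_assoc, hac, one_mul]
    have e2 : b * (1 - q) * (q * c) = 0 := by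
      rw [mul_assoc, ← mul_assoc (1 - q), hrq]; simp
    have e3 : a * q * ((1 - q) * d) = 0 := by
      rw [mul_assoc, ← mul_assoc q, hqr]; simp
    have e4 : b * (1 - q) * ((1 - q) * d) = 1 - q := by
      rw [mul_assoc, ← mul_assoc (1 - q), hrr, hd, ← mul_assoc, hbd, one_mul]
    rw [e1, e2, e3, e4]; abel
  refine ⟨⟨add_mem (mul_mem hyS hqS) (mul_mem hyS' (sub_mem (one_mem S) hqS)),
    (mem_centralizer_singleton hqs).2 ?_⟩, ?_, ?_⟩
  · rw [mul_add, add_mul, ← mul_assoc, ← mul_assoc, hyq, hyq', mul_assoc y', mul_assoc y',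
      hqr, hrq]
  · rw [isSelfAdjoint_iff, star_add, star_mul, star_mul, hqs, hrs, hy.star_eq, hy'.star_eq, hyq,
      hyr']
  · obtain ⟨v, rfl⟩ := hyu
    obtain ⟨v', rfl⟩ := hyu'
    have c1 : q * (v⁻¹ : Bˣ).1 = (v⁻¹ : Bˣ).1 * q :=
      (show Commute q (v : B) from hyq).units_inv_right
    have c2 : (1 - q) * (v'⁻¹ : Bˣ).1 = (v'⁻¹ : Bˣ).1 * (1 - q) :=
      (show Commute (1 - q) (v' : B) from hyr').units_inv_right
    exact ⟨⟨_, v⁻¹.1 * q + v'⁻¹.1 * (1 - q), key c1 c2 v.mul_inv v'.mul_inv,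
      key hyq hyr' v.inv_mul v'.inv_mul⟩, rfl⟩

/-- Every self-adjoint element of `S` is a limit of elements `L d L*` with `L` invertible in `S`
and `d` invertible and self-adjoint in `S ⊓ D`. -/
def CongruenceDense (S D : StarSubalgebra ℂ B) : Prop :=
  ∀ a ∈ S, IsSelfAdjoint a → a ∈ closure {b | ∃ L ∈ S, ∃ d ∈ S ⊓ D,
    IsUnit L ∧ IsUnit d ∧ IsSelfAdjoint d ∧ b = L * d * star L}

/-- Replacing the block-diagonal part of `a` by a nearby invertible `c'` permits an `L D L*`
factorization of the perturbed element. The middle factor, a Schur complement, is again block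
diagonal, so the hypothesis is used a second time on it. -/
theorem CongruenceDense.of_inf_centralizer {S D : StarSubalgebra ℂ B} [hS : IsClosed (S : Set B)]
    {e : B} (he : IsStarProjection e) (heS : e ∈ S)
    (h : CongruenceDense (S ⊓ StarSubalgebra.centralizer ℂ {e}) D) : CongruenceDense S D := by
  intro a haS ha
  have hee : e * e = e := he.isIdempotentElem
  have hes : star e = e := he.isSelfAdjoint
  have her : e * (1 - e) = 0 := by rw [mul_sub, hee, mul_one, sub_self]
  have hre : (1 - e) * e = 0 := by rw [sub_mul, hee, one_mul, sub_self]
  have hrs : star (1 - e) = 1 - e := by rw [star_sub, hes, star_one]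
  have hrS : 1 - e ∈ S := sub_mem (one_mem S) heS
  set c := e * a * e + (1 - e) * a * (1 - e) with hc
  have hcS : c ∈ S ⊓ StarSubalgebra.centralizer ℂ {e} := by
    refine ⟨add_mem (mul_mem (mul_mem heS haS) heS) (mul_mem (mul_mem hrS haS) hrS),
      (mem_centralizer_singleton hes).2 ?_⟩
    simp only [hc, mul_add, add_mul, ← mul_assoc, her, hee]
    simp only [mul_assoc, hee, hre]; simp
  have hcsa : IsSelfAdjoint c := by
    simp only [isSelfAdjoint_iff, hc, star_add, star_mul, hes, hrs, ha.star_eq, mul_assoc]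
  have ha' : a = (a - c) + c := by abel
  rw [ha', ← closure_closure]
  refine map_mem_closure (f := fun z => (a - c) + z) (by fun_prop) (h c hcS hcsa) ?_
  rintro c' ⟨L, hL, d, hd, hLu, hdu, hdsa, rfl⟩
  set c' := L * d * star L with hc'
  have hc'S : c' ∈ S ⊓ StarSubalgebra.centralizer ℂ {e} :=
    mul_mem (mul_mem hL hd.1) (star_mem hL)
  have hc'sa : IsSelfAdjoint c' := by
    simp only [isSelfAdjoint_iff, hc', star_mul, star_star, hdsa.star_eq, mul_assoc]
  have hc'u : IsUnit c' := (hLu.mul hdu).mul hLu.star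
  have := isClosed_inf_centralizer S {e}
  have hJS := inverse_mem_of_isClosed hc'S
  have hJsa := inverse_isSelfAdjoint hc'sa
  have hJc := Ring.inverse_mul_cancel _ hc'u
  have hcJ := Ring.mul_inverse_cancel _ hc'u
  set J := Ring.inverse c'
  have heJ : e * J = J * e := (mem_centralizer_singleton hes).1 hJS.2
  set y := (1 - e) * a * e with hy
  have hystar : star y = e * a * (1 - e) := by
    simp only [hy, star_mul, hes, hrs, ha.star_eq, mul_assoc]
  have hyJy : y * J * y = 0 := by
    calc y * J * y = (1 - e) * a * (e * J) * (1 - e) * a * e := by simp only [hy, mul_assoc]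
      _ = (1 - e) * a * J * (e * (1 - e)) * a * e := by rw [heJ]; simp only [mul_assoc]
      _ = 0 := by rw [her]; simp
  have hzJz : star y * J * star y = 0 := by
    have := congrArg star hyJy
    simpa [mul_assoc, hJsa.star_eq] using this
  have hyS : y ∈ S := mul_mem (mul_mem hrS haS) heS
  have hm : c' - y * J * star y ∈ S ⊓ StarSubalgebra.centralizer ℂ {e} := by
    refine sub_mem hc'S ⟨mul_mem (mul_mem hyS hJS.1) (star_mem hyS),
      (mem_centralizer_singleton hes).2 ?_⟩
    rw [hystar, hy]
    simp only [← mul_assoc, her]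
    simp only [mul_assoc, hre]; simp
  have hmsa : IsSelfAdjoint (c' - y * J * star y) := by
    simp only [isSelfAdjoint_iff, star_sub, star_mul, star_star, hc'sa.star_eq, hJsa.star_eq,
      mul_assoc]
  have hsum : a - c + c' = (1 + y * J) * (c' - y * J * star y) * (1 + J * star y) := by
    rw [unipotent_mul_mul_unipotent hJc hcJ hyJy hzJz, hystar, hy, hc]
    simp only [sub_mul, mul_sub, one_mul, mul_one]; abel
  have hLstar : star (1 + y * J) = 1 + J * star y := by
    rw [star_add, star_mul, star_one, hJsa.star_eq]
  have hLu' : IsUnit (1 + y * J) := by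
    have := isUnit_one_sub_of_mul_self_eq_zero (x := -(y * J))
      (by rw [neg_mul_neg, ← mul_assoc, hyJy, zero_mul])
    simpa using this
  change a - c + c' ∈ _
  rw [hsum]
  refine map_mem_closure (f := fun z => (1 + y * J) * z * (1 + J * star y)) (by fun_prop)
    (h _ hm hmsa) ?_
  rintro _ ⟨L', hL', d', hd', hLu'', hdu', hdsa', rfl⟩
  refine ⟨(1 + y * J) * L', mul_mem (add_mem (one_mem S) (mul_mem hyS hJS.1)) hL'.1, d',
    ⟨hd'.1.1, hd'.2⟩, hLu'.mul hLu'', hdu', hdsa', ?_⟩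
  simp only [star_mul (1 + y * J), hLstar, mul_assoc]

/-- The projections are adjoined to the commutant one at a time; as they commute, the next one
always lies in the algebra already cut down. -/
theorem CongruenceDense.of_finset {ι : Type*} {E : ι → B} (hE : ∀ i, IsStarProjection (E i))
    (hcomm : ∀ i j, E i * E j = E j * E i) {D : StarSubalgebra ℂ B} (s : Finset ι)
    (S : StarSubalgebra ℂ B) [hS : IsClosed (S : Set B)] (hES : ∀ i, E i ∈ S)
    (h : CongruenceDense (S ⊓ StarSubalgebra.centralizer ℂ (E '' s)) D) :
    CongruenceDense S D := by
  classical
  induction s using Finset.induction_on with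
  | empty =>
    have : S ⊓ StarSubalgebra.centralizer ℂ (E '' (∅ : Finset ι)) = S := by
      refine inf_eq_left.2 fun x _ => ?_
      simp [StarSubalgebra.mem_centralizer_iff]
    rwa [this] at h
  | insert e s _ ih =>
    apply ih
    have := isClosed_inf_centralizer S (E '' s)
    refine CongruenceDense.of_inf_centralizer (hE e) ⟨hES e, ?_⟩ ?_
    · change E e ∈ StarSubalgebra.centralizer ℂ (E '' s)
      rw [StarSubalgebra.mem_centralizer_iff]
      rintro _ ⟨j, _, rfl⟩
      rw [(hE j).isSelfAdjoint.star_eq]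
      exact ⟨hcomm _ _, hcomm _ _⟩
    · convert h using 1
      rw [inf_assoc]
      congr 1
      ext x
      simp only [StarSubalgebra.mem_inf, StarSubalgebra.mem_centralizer_iff]
      simp only [Finset.coe_insert, Set.image_insert_eq, Set.forall_mem_insert,
        Set.mem_singleton_iff, forall_eq, and_comm]

theorem CongruenceDense.of_selfAdjointUnitsDense {ι : Type*} [Finite ι] {E : ι → B}
    (hE : ∀ i, IsStarProjection (E i)) (hcomm : ∀ i j, E i * E j = E j * E i)
    (S : StarSubalgebra ℂ B) [hS : IsClosed (S : Set B)] (hES : ∀ i, E i ∈ S)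
    (h : SelfAdjointUnitsDense (S ⊓ StarSubalgebra.centralizer ℂ (Set.range E))) :
    CongruenceDense S (StarSubalgebra.centralizer ℂ (Set.range E)) := by
  have := Fintype.ofFinite ι
  refine CongruenceDense.of_finset hE hcomm Finset.univ S hES ?_
  rw [Finset.coe_univ, Set.image_univ]
  intro a ha hasa
  refine closure_mono ?_ (h a ha hasa)
  rintro d ⟨hd, hdsa, hdu⟩
  exact ⟨1, one_mem _, d, ⟨hd, hd.2⟩, isUnit_one, hdu, hdsa, by simp⟩

end CStarRank

/-! ### Signs of invertible elements and approximate diagonalization -/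

namespace CStarRank

open Filter Topology

variable {B : Type*} [CStarAlgebra B]

theorem spectrum_ne_zero_of_isUnit {x : B} (hu : IsUnit x) {t : ℝ} (ht : t ∈ spectrum ℝ x) :
    t ≠ 0 := by
  rintro rfl
  exact (spectrum.zero_notMem_iff ℝ).2 hu ht

theorem continuousOn_sign_of_zero_notMem {s : Set ℝ} (h : ∀ t ∈ s, t ≠ 0) :
    ContinuousOn (fun t : ℝ => (SignType.sign t : ℝ)) s := by
  intro t ht
  refine ContinuousAt.continuousWithinAt ?_
  exact (continuous_of_discreteTopology (f := fun s : SignType => (s : ℝ))).continuousAt.comp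
    (continuousAt_sign_of_ne_zero (h t ht))

/-- The sign of an invertible self-adjoint element. -/
noncomputable def signElem (x : B) : B := cfc (fun t : ℝ => (SignType.sign t : ℝ)) x

theorem signElem_isSelfAdjoint (x : B) : IsSelfAdjoint (signElem x) := cfc_predicate _ _

theorem signElem_mul_self {x : B} (hx : IsSelfAdjoint x) (hu : IsUnit x) :
    signElem x * signElem x = 1 := by
  have hc := continuousOn_sign_of_zero_notMem fun t ht => spectrum_ne_zero_of_isUnit hu ht
  rw [signElem, ← cfc_mul _ _ x hc hc, ← cfc_one ℝ x]
  refine cfc_congr fun t ht => ?_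
  rcases (spectrum_ne_zero_of_isUnit hu ht).lt_or_gt with h | h <;> simp [h]

/-- `|x|^{1/2}` and its inverse conjugate the sign of `x` to `x` and back. -/
theorem exists_sqrt_abs {x : B} (hx : IsSelfAdjoint x) (hu : IsUnit x) {S : StarSubalgebra ℂ B}
    [IsClosed (S : Set B)] (hxS : x ∈ S) :
    ∃ g ∈ S, ∃ h ∈ S, IsSelfAdjoint g ∧ IsSelfAdjoint h ∧ g * h = 1 ∧ h * g = 1 ∧
      g * signElem x * g = x ∧ h * x * h = signElem x := by
  have h0 : ∀ t ∈ spectrum ℝ x, t ≠ 0 := fun t ht => spectrum_ne_zero_of_isUnit hu ht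
  have hc := continuousOn_sign_of_zero_notMem h0
  have hg : ContinuousOn (fun t : ℝ => √|t|) (spectrum ℝ x) := by fun_prop
  have hh : ContinuousOn (fun t : ℝ => (√|t|)⁻¹) (spectrum ℝ x) :=
    hg.inv₀ fun t ht => (Real.sqrt_pos.2 (abs_pos.2 (h0 t ht))).ne'
  have h1 : cfc (fun t : ℝ => √|t|) x * cfc (fun t : ℝ => (√|t|)⁻¹) x = 1 := by
    rw [← cfc_mul _ _ x hg hh, ← cfc_one ℝ x]
    exact cfc_congr fun t ht => mul_inv_cancel₀ (Real.sqrt_pos.2 (abs_pos.2 (h0 t ht))).ne'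
  have h2 : cfc (fun t : ℝ => √|t|) x * signElem x * cfc (fun t : ℝ => √|t|) x = x := by
    rw [signElem, ← cfc_mul _ _ x hg hc, ← cfc_mul (fun t : ℝ => √|t| * (SignType.sign t : ℝ)) _ x (hg.mul hc) hg]
    refine (cfc_congr (g := id) fun t ht => ?_).trans (cfc_id ℝ x)
    have : √|t| * √|t| = |t| := Real.mul_self_sqrt (abs_nonneg t)
    calc √|t| * (SignType.sign t : ℝ) * √|t| = (√|t| * √|t|) * SignType.sign t := by ring
      _ = t := by rw [this, abs_mul_sign]
  have h3 : cfc (fun t : ℝ => (√|t|)⁻¹) x * cfc (fun t : ℝ => √|t|) x = 1 := by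
    rw [cfc_commute_cfc, h1]
  refine ⟨_, cfc_mem (fun t : ℝ => √|t|) hxS, _, cfc_mem (fun t : ℝ => (√|t|)⁻¹) hxS,
    cfc_predicate _ _, cfc_predicate _ _, h1, h3, h2, ?_⟩
  set g := cfc (fun t : ℝ => √|t|) x
  set h := cfc (fun t : ℝ => (√|t|)⁻¹) x
  calc h * x * h = h * (g * signElem x * g) * h := by rw [h2]
    _ = (h * g) * signElem x * (g * h) := by simp only [mul_assoc]
    _ = signElem x := by rw [h1, h3]; simp

/-- If `N s N*` is a symmetry for a symmetry `s` and an invertible `N`, the unitary part of `N`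
already conjugates `s` to it. -/
theorem exists_unitary_conj_of_congr {S : StarSubalgebra ℂ B} [IsClosed (S : Set B)] {N s : B}
    (hN : N ∈ S) (hNu : IsUnit N) (hs : IsSelfAdjoint s) (hss : s * s = 1)
    (hσσ : N * s * star N * (N * s * star N) = 1) :
    ∃ u ∈ S, u ∈ unitary B ∧ star u * (N * s * star N) * u = s := by
  let _ := CStarAlgebra.spectralOrder B
  have := CStarAlgebra.spectralOrderedRing B
  have hH : 0 ≤ star N * N := star_mul_self_nonneg N
  have hHS : star N * N ∈ S := mul_mem (star_mem hN) hN
  have hHu : IsUnit (star N * N) := hNu.star.mul hNu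
  -- `P` is the absolute value of `N`, so that `N` times its inverse `Q` is the unitary part of `N`.
  obtain ⟨P, hP0, hPP, hPS⟩ : ∃ P : B, 0 ≤ P ∧ P * P = star N * N ∧ P ∈ S := by
    refine ⟨cfc Real.sqrt (star N * N), cfc_nonneg fun t _ => Real.sqrt_nonneg t, ?_,
      cfc_mem Real.sqrt hHS⟩
    rw [← cfc_mul _ _ (star N * N)]
    nth_rw 2 [← cfc_id ℝ (star N * N)]
    exact cfc_congr fun t ht => Real.mul_self_sqrt (spectrum_nonneg_of_nonneg hH ht)
  have hPsa : IsSelfAdjoint P := IsSelfAdjoint.of_nonneg hP0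
  have hPu : IsUnit P := by
    rw [← hPP] at hHu
    exact (Commute.isUnit_mul_iff (Commute.refl P)).1 hHu |>.1
  have hQS := inverse_mem_of_isClosed hPS
  have hQsa := inverse_isSelfAdjoint hPsa
  have hQP := Ring.inverse_mul_cancel _ hPu
  have hPQ := Ring.mul_inverse_cancel _ hPu
  set Q := Ring.inverse P
  have hQ0 : 0 ≤ Q := by
    have := conjugate_nonneg_of_nonneg hP0 (c := Q) ?_
    · rwa [hQP, one_mul] at this
    · have h2 := star_left_conjugate_nonneg hP0 Q
      rw [hQsa.star_eq, hQP, one_mul] at h2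
      exact h2
  have huu : star (N * Q) * (N * Q) = 1 := by
    calc star (N * Q) * (N * Q) = Q * (star N * N) * Q := by
          rw [star_mul, hQsa.star_eq]; simp only [mul_assoc]
      _ = (Q * P) * (P * Q) := by rw [← hPP]; simp only [mul_assoc]
      _ = 1 := by rw [hQP, hPQ, one_mul]
  have hQu : IsUnit Q := ⟨⟨Q, P, hQP, hPQ⟩, rfl⟩
  have huu' : N * Q * star (N * Q) = 1 := by
    obtain ⟨v, hv⟩ := hNu.mul hQu
    rw [← hv] at huu ⊢
    rw [← Units.inv_eq_of_mul_eq_one_left huu, v.mul_inv]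
  have hconj : star (N * Q) * (N * s * star N) * (N * Q) = P * s * P := by
    calc star (N * Q) * (N * s * star N) * (N * Q)
        = Q * (star N * N) * s * (star N * N) * Q := by
          rw [star_mul, hQsa.star_eq]; simp only [mul_assoc]
      _ = (Q * P) * P * s * P * (P * Q) := by rw [← hPP]; simp only [mul_assoc]
      _ = P * s * P := by rw [hQP, hPQ, one_mul, mul_one]
  have hsq : P * s * P * (P * s * P) = 1 := by
    rw [← hconj]
    set u := N * Q
    set σ := N * s * star N
    calc star u * σ * u * (star u * σ * u) = star u * σ * (u * star u) * σ * u := by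
          simp only [mul_assoc]
      _ = star u * (σ * σ) * u := by rw [huu']; simp only [mul_assoc, one_mul]
      _ = 1 := by rw [hσσ, mul_one, huu]
  -- Both sides are positive, and `hsq` says that they have the same square; positive square roots
  -- are unique.
  have hroot : s * P * s = Q := by
    have h0 : 0 ≤ s * P * s := by
      have := star_left_conjugate_nonneg hP0 s
      rwa [hs.star_eq] at this
    rw [← CFC.mul_self_eq_mul_self_iff _ _ h0 hQ0]
    calc s * P * s * (s * P * s) = s * P * (s * s) * P * s := by simp only [mul_assoc]
      _ = s * P * P * s := by rw [hss, mul_one]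
      _ = (Q * P) * (s * P * P * s) * (P * Q) := by rw [hQP, hPQ]; simp
      _ = Q * (P * s * P * (P * s * P)) * Q := by simp only [mul_assoc]
      _ = Q * Q := by rw [hsq, mul_one]
  refine ⟨N * Q, mul_mem hN hQS, ⟨huu, huu'⟩, ?_⟩
  rw [hconj]
  calc P * s * P = P * (s * P * s) * s := by simp only [mul_assoc, hss, mul_one]
    _ = s := by rw [hroot, hPQ, one_mul]

/-- An invertible self-adjoint element congruent to `d` has its sign unitarily conjugate to the
sign of `d`. -/
theorem exists_unitary_conj_signElem {S : StarSubalgebra ℂ B} [IsClosed (S : Set B)] {L d : B}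
    (hL : L ∈ S) (hd : d ∈ S) (hLu : IsUnit L) (hdu : IsUnit d) (hdsa : IsSelfAdjoint d) :
    ∃ u ∈ S, u ∈ unitary B ∧ star u * signElem (L * d * star L) * u = signElem d := by
  set b := L * d * star L with hb
  have hbS : b ∈ S := mul_mem (mul_mem hL hd) (star_mem hL)
  have hbu : IsUnit b := (hLu.mul hdu).mul hLu.star
  have hbsa : IsSelfAdjoint b := by
    simp only [isSelfAdjoint_iff, hb, star_mul, star_star, hdsa.star_eq, mul_assoc]
  obtain ⟨g, hg, g', -, hgsa, -, hgg', hg'g, hgd, -⟩ := exists_sqrt_abs hdsa hdu hd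
  obtain ⟨h', -, h, hh, -, hhsa, hh'h, hhh', -, hhb⟩ := exists_sqrt_abs hbsa hbu hbS
  have hN : h * L * g * signElem d * star (h * L * g) = signElem b := by
    calc _ = h * (L * (g * signElem d * g) * star L) * h := by
          simp only [star_mul, hgsa.star_eq, hhsa.star_eq, mul_assoc]
      _ = signElem b := by rw [hgd, hhb]
  have hNu : IsUnit (h * L * g) :=
    ((IsUnit.mul (⟨⟨h, h', hhh', hh'h⟩, rfl⟩ : IsUnit h) hLu)).mul ⟨⟨g, g', hgg', hg'g⟩, rfl⟩
  have := exists_unitary_conj_of_congr (S := S) (mul_mem (mul_mem hh hL) hg) hNu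
    (signElem_isSelfAdjoint d) (signElem_mul_self hdsa hdu)
    (by rw [hN]; exact signElem_mul_self hbsa hbu)
  rwa [hN] at this

/-- On the spectrum the distance from `t` to `M * sign t` is the distance from `|t|` to `M`, so a
norm bound near `2 * M` is nearly halved. -/
theorem norm_sub_smul_signElem_le {b : B} (hb : IsSelfAdjoint b) (hu : IsUnit b) {M η : ℝ}
    (hM : 0 ≤ M) (hη : 0 ≤ η) (h : ‖b‖ ≤ 2 * M + η) :
    ‖b - (M : ℂ) • signElem b‖ ≤ M + η := by
  have hc := continuousOn_sign_of_zero_notMem fun t ht => spectrum_ne_zero_of_isUnit hu ht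
  have : b - (M : ℂ) • signElem b = cfc (fun t : ℝ => t - M * (SignType.sign t : ℝ)) b := by
    rw [cfc_sub _ _ b, cfc_const_mul .., cfc_id' ℝ b, signElem, Complex.coe_smul]
  rw [this]
  refine norm_cfc_le (by positivity) fun t ht => ?_
  have ht' : |t| ≤ ‖b‖ := by
    have : Nontrivial B := by
      by_contra hn
      rw [not_nontrivial_iff_subsingleton] at hn
      simp at ht
    simpa using spectrum.norm_le_norm_mul_of_mem ht
  rw [Real.norm_eq_abs]
  rcases (spectrum_ne_zero_of_isUnit hu ht).lt_or_gt with h' | h'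
  · rw [abs_of_neg h'] at ht'
    rw [sign_neg h', abs_le]
    simp only [SignType.coe_neg_one]
    constructor <;> linarith
  · rw [abs_of_pos h'] at ht'
    rw [sign_pos h', abs_le]
    simp only [SignType.coe_one]
    constructor <;> linarith

theorem norm_star_mul_mul_unitary {u : B} (hu : u ∈ unitary B) (x : B) :
    ‖star u * x * u‖ = ‖x‖ := by
  rw [CStarRing.norm_mul_mem_unitary _ hu, CStarRing.norm_mem_unitary_mul _ (Unitary.star_mem hu)]

/-- Approximate diagonalization, by induction on the size of the norm. -/
theorem exists_unitary_norm_conj_sub_le {ι : Type*} [Finite ι] {E : ι → B}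
    (hE : ∀ i, IsStarProjection (E i)) (hcomm : ∀ i j, E i * E j = E j * E i) {ε : ℝ} (hε : 0 < ε)
    (k : ℕ) : ∀ (S : StarSubalgebra ℂ B), IsClosed (S : Set B) → (∀ i, E i ∈ S) →
      SelfAdjointUnitsDense (S ⊓ StarSubalgebra.centralizer ℂ (Set.range E)) →
      ∀ η > 0, ∀ a ∈ S, IsSelfAdjoint a → ‖a‖ ≤ (3 / 2) ^ k * ε →
      ∃ u ∈ S, u ∈ unitary B ∧ ∃ d ∈ S ⊓ StarSubalgebra.centralizer ℂ (Set.range E),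
        IsSelfAdjoint d ∧ ‖star u * a * u - d‖ ≤ ε + η := by
  set D := StarSubalgebra.centralizer ℂ (Set.range E) with hD
  have hDcl : IsClosed (D : Set B) := by
    rw [hD, StarSubalgebra.coe_centralizer]; exact Set.isClosed_centralizer _
  induction k with
  | zero =>
    intro S _ _ _ η hη a _ _ ha
    refine ⟨1, one_mem S, one_mem _, 0, zero_mem _, .zero _, ?_⟩
    simp only [pow_zero, one_mul] at ha
    simpa using ha.trans (by linarith)
  | succ k ih =>
    intro S hS hES hSD η hη a haS ha hnorm
    -- The current bound is `2 * M` and the bound of the previous stage is `4 / 3 * M`. Hence `θ ≤ M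
    -- / 3` suffices for the remainder, of norm at most `M + θ`, to fall under the induction
    -- hypothesis; `θ ≤ η / 2` leaves half of `η` for it.
    set M := (3 / 2 : ℝ) ^ k * ε * (3 / 4) with hM
    have hMpos : 0 < M := by positivity
    have hk : (3 / 2 : ℝ) ^ (k + 1) * ε = 2 * M := by rw [hM, pow_succ]; ring
    rw [hk] at hnorm
    set θ := min (η / 2) (M / 3) with hθ
    have hθpos : 0 < θ := by positivity
    have hP := CongruenceDense.of_selfAdjointUnitsDense hE hcomm S hES hSD
    obtain ⟨b, ⟨L, hL, d, hd, hLu, hdu, hdsa, hb⟩, hab⟩ :=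
      Metric.mem_closure_iff.1 (hP a haS ha) θ hθpos
    rw [dist_eq_norm] at hab
    obtain ⟨u, huS, hu, hus⟩ := exists_unitary_conj_signElem hL hd.1 hLu hdu hdsa
    rw [← hb] at hus
    have hbsa : IsSelfAdjoint b := by
      simp only [isSelfAdjoint_iff, hb, star_mul, star_star, hdsa.star_eq, mul_assoc]
    have hbS : b ∈ S := hb ▸ mul_mem (mul_mem hL hd.1) (star_mem hL)
    have hbu : IsUnit b := hb ▸ (hLu.mul hdu).mul hLu.star
    set s := signElem d with hs
    have hssa : IsSelfAdjoint s := signElem_isSelfAdjoint d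
    have hss : s * s = 1 := signElem_mul_self hdsa hdu
    have hsS : s ∈ S := cfc_mem _ hd.1
    have hsD : s ∈ D := cfc_mem _ hd.2
    -- The positive spectral projection of `d`: commuting with `q` is the same as commuting with
    -- `s`.
    set q : B := (1 / 2 : ℂ) • (1 + s) with hq
    have hqS : q ∈ S := S.smul_mem (add_mem (one_mem S) hsS) _
    have hqD : q ∈ D := D.smul_mem (add_mem (one_mem D) hsD) _
    have hqp : IsStarProjection q := by
      refine ⟨?_, ?_⟩
      · change q * q = q
        rw [hq, smul_mul_smul_comm, mul_add, add_mul, add_mul, hss]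
        simp only [one_mul, mul_one]
        rw [show (1 + s + (s + 1) : B) = (2 : ℂ) • (1 + s) by rw [two_smul]; abel, smul_smul]
        norm_num
      · rw [isSelfAdjoint_iff, hq, star_smul, star_add, star_one, hssa.star_eq]
        simp
    have hqs : s = (2 : ℂ) • q - 1 := by rw [hq, smul_smul]; norm_num
    set c := star u * (b - (M : ℂ) • signElem b) * u with hc
    have hcnorm : ‖c‖ ≤ M + θ := by
      rw [hc, norm_star_mul_mul_unitary hu]
      refine norm_sub_smul_signElem_le hbsa hbu hMpos.le hθpos.le ?_
      calc ‖b‖ = ‖a - (a - b)‖ := by rw [sub_sub_cancel]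
        _ ≤ ‖a‖ + ‖a - b‖ := norm_sub_le _ _
        _ ≤ 2 * M + θ := by linarith
    have hsig : IsSelfAdjoint (signElem b) := signElem_isSelfAdjoint b
    have hsigS : signElem b ∈ S := cfc_mem _ hbS
    have hcsa : IsSelfAdjoint c := by
      simp only [isSelfAdjoint_iff, hc, star_mul, star_sub, star_smul, star_star, hbsa.star_eq,
        hsig.star_eq, mul_assoc, RCLike.star_def, Complex.conj_ofReal]
    have hcS : c ∈ S := mul_mem (mul_mem (star_mem huS) (sub_mem hbS (S.smul_mem hsigS _))) huS
    have huu : u * star u = 1 := hu.2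
    have hbcomm : signElem b * b = b * signElem b := by
      have := cfc_commute_cfc (fun t : ℝ => (SignType.sign t : ℝ)) id b
      rw [cfc_id ℝ b] at this
      exact this
    have hsc : s * c = c * s := by
      have key : ∀ x y : B, star u * x * u * (star u * y * u) = star u * (x * y) * u := by
        intro x y
        calc _ = star u * x * (u * star u) * y * u := by simp only [mul_assoc]
          _ = _ := by rw [huu]; simp only [mul_assoc, one_mul]
      rw [← hus, hc, key, key, mul_sub, sub_mul, hbcomm, mul_smul_comm, smul_mul_assoc]
    have hqc : q * c = c * q := by
      rw [hq, smul_mul_assoc, mul_smul_comm, add_mul, mul_add, hsc]; simp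
    have hE' : ∀ i, E i ∈ S ⊓ StarSubalgebra.centralizer ℂ {q} := by
      refine fun i => ⟨hES i, (mem_centralizer_singleton hqp.isSelfAdjoint).2 ?_⟩
      exact ((StarSubalgebra.mem_centralizer_iff ℂ).1 hqD (E i) ⟨i, rfl⟩).1.symm
    have hSD' : SelfAdjointUnitsDense (S ⊓ StarSubalgebra.centralizer ℂ {q} ⊓ D) := by
      rw [inf_right_comm]
      have : IsClosed ((S ⊓ D : StarSubalgebra ℂ B) : Set B) := by
        rw [StarSubalgebra.coe_inf]; exact hS.inter hDcl
      exact hSD.inf_centralizer hqp ⟨hqS, hqD⟩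
    -- Working in the commutant of `q` makes `u'` commute with `s`, so conjugation by `u'` leaves
    -- the subtracted term `M • s` in place.
    obtain ⟨u', hu'S, hu', d', hd', hd'sa, hle⟩ := ih (S ⊓ StarSubalgebra.centralizer ℂ {q})
      (isClosed_inf_centralizer S {q}) hE' hSD' (η / 2) (by positivity) c
      ⟨hcS, (mem_centralizer_singleton hqp.isSelfAdjoint).2 hqc⟩ hcsa
      (hcnorm.trans (by
        have := min_le_right (η / 2) (M / 3)
        rw [← hθ] at this
        rw [hM] at this ⊢
        linarith))
    have hqu' : q * u' = u' * q := (mem_centralizer_singleton hqp.isSelfAdjoint).1 hu'S.2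
    have hsu' : s * u' = u' * s := by
      rw [hqs, sub_mul, mul_sub, smul_mul_assoc, mul_smul_comm, hqu', one_mul, mul_one]
    refine ⟨u * u', mul_mem huS hu'S.1, mul_mem hu hu', d' + (M : ℂ) • s,
      ⟨add_mem hd'.1.1 (S.smul_mem hsS _), add_mem hd'.2 (D.smul_mem hsD _)⟩, ?_, ?_⟩
    · simp only [isSelfAdjoint_iff, star_add, star_smul, hd'sa.star_eq, hssa.star_eq,
        RCLike.star_def, Complex.conj_ofReal]
    have hu'u' : star u' * u' = 1 := hu'.1
    have hcb : star u * b * u = c + (M : ℂ) • s := by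
      rw [hc, ← hus, mul_sub, sub_mul, mul_smul_comm, smul_mul_assoc]; abel
    have hsplit : star (u * u') * a * (u * u') - (d' + (M : ℂ) • s) =
        star (u * u') * (a - b) * (u * u') + (star u' * c * u' - d') := by
      have h1 : star (u * u') * b * (u * u') = star u' * c * u' + (M : ℂ) • s := by
        calc _ = star u' * (star u * b * u) * u' := by simp only [star_mul, mul_assoc]
          _ = star u' * c * u' + (M : ℂ) • (star u' * (s * u')) := by
            rw [hcb, mul_add, add_mul, mul_smul_comm, smul_mul_assoc, mul_assoc _ s]
          _ = _ := by rw [hsu', ← mul_assoc (star u') u' s, hu'u', one_mul]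
      rw [mul_sub, sub_mul, h1]; abel
    rw [hsplit]
    have hθη : θ ≤ η / 2 := min_le_left _ _
    calc _ ≤ ‖star (u * u') * (a - b) * (u * u')‖ + ‖star u' * c * u' - d'‖ := norm_add_le _ _
      _ ≤ θ + (ε + η / 2) := by
        rw [norm_star_mul_mul_unitary (mul_mem hu hu')]; exact add_le_add hab.le hle
      _ ≤ ε + η := by linarith

/-- If the commutant `D` of finitely many commuting projections has dense self-adjoint units, then
every self-adjoint element is, up to a small error, unitarily conjugate to an element of `D`. -/
theorem exists_unitary_norm_conj_sub_lt {ι : Type*} [Finite ι] {E : ι → B}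
    (hE : ∀ i, IsStarProjection (E i)) (hcomm : ∀ i j, E i * E j = E j * E i)
    (hD : SelfAdjointUnitsDense (StarSubalgebra.centralizer ℂ (Set.range E)))
    {a : B} (ha : IsSelfAdjoint a) {ε : ℝ} (hε : 0 < ε) :
    ∃ u ∈ unitary B, ∃ d ∈ StarSubalgebra.centralizer ℂ (Set.range E),
      IsSelfAdjoint d ∧ ‖star u * a * u - d‖ < ε := by
  obtain ⟨k, hk⟩ := pow_unbounded_of_one_lt (‖a‖ / (ε / 3)) (by norm_num : (1 : ℝ) < 3 / 2)
  rw [div_lt_iff₀ (by positivity)] at hk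
  obtain ⟨u, -, hu, d, hd, hdsa, h⟩ := exists_unitary_norm_conj_sub_le hE hcomm
    (by positivity : 0 < ε / 3) k ⊤ (by simp) (fun i => StarSubalgebra.mem_top)
    (by rwa [top_inf_eq]) (ε / 3) (by positivity) a StarSubalgebra.mem_top ha hk.le
  exact ⟨u, hu, d, hd.2, hdsa, h.trans_lt (by linarith)⟩

end CStarRank

/-! ### Density consequences of the three rank conditions -/

namespace CStarRank

open Filter Topology

variable {A : Type*} [CStarAlgebra A]

section RealRank

theorem dense_isUnit_selfAdjoint (h : realRank A = 0) :
    Dense {x : selfAdjoint A | IsUnit (x : A)} := by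
  have hd : Dense (lgSA A 1) := by
    by_contra hd
    have : (1 : ℕ∞) ≤ realRank A := by
      refine le_iInf₂ fun k hk => ?_
      rcases k with _ | k
      · exact absurd hk hd
      · exact_mod_cast Nat.succ_le_succ (Nat.zero_le k)
    rw [h] at this
    exact absurd this (by simp)
  intro x
  refine map_mem_closure (f := fun a : Fin 1 → selfAdjoint A => a 0) (by fun_prop)
    (hd fun _ => x) fun a ha => ?_
  have ha' : IsUnit (∑ i, star (a i : A) * (a i : A)) := ha
  simp only [Finset.univ_unique, Fin.default_eq_zero, Finset.sum_singleton, (a 0).2.star_eq] at ha'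
  exact ((Commute.refl (a 0 : A)).isUnit_mul_iff.1 ha').1

/-- Baire's theorem: each translate of the invertible self-adjoint elements is open and dense, and
there are countably many. -/
theorem dense_forall_isUnit_sub (h : Dense {x : selfAdjoint A | IsUnit (x : A)}) (t : ℤ → ℝ) :
    Dense {x : selfAdjoint A | ∀ j, IsUnit ((x : A) - algebraMap ℝ A (t j))} := by
  have : CompleteSpace (selfAdjoint A) :=
    (isClosed_eq continuous_star continuous_id : IsClosed {x : A | star x = x}).completeSpace_coe
  have hsa : ∀ r : ℝ, IsSelfAdjoint (algebraMap ℝ A r) := fun r => .algebraMap A (.all r)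
  rw [Set.ofPred_forall]
  refine dense_iInter_of_isOpen (fun j => ?_) fun j x => ?_
  · exact Units.isOpen.preimage
      (f := fun x : selfAdjoint A => (x : A) - algebraMap ℝ A (t j)) (by fun_prop)
  · let c : selfAdjoint A := ⟨algebraMap ℝ A (t j), hsa _⟩
    have := map_mem_closure (f := fun y : selfAdjoint A => y + c) (by fun_prop) (h (x - c))
      (t := {x : selfAdjoint A | IsUnit ((x : A) - algebraMap ℝ A (t j))}) fun y hy => by
        simpa [c] using hy
    simpa using this

/-- In real rank zero, self-adjoint elements are approximated by ones with spectrum in the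
translated lattice `δ (ℤ + r)`. -/
theorem exists_fract_eq_of_dense (h : Dense {x : selfAdjoint A | IsUnit (x : A)})
    (x : selfAdjoint A) {δ : ℝ} (hδ : 0 < δ) {r : ℝ} (hr0 : 0 ≤ r) (hr1 : r < 1) :
    ∃ y : selfAdjoint A, dist x y < 2 * δ ∧ ∀ t ∈ spectrum ℝ (y : A), Int.fract (t / δ) = r := by
  obtain ⟨z, hz, hxz⟩ := Metric.mem_closure_iff.1
    (dense_forall_isUnit_sub h (fun j : ℤ => δ * j) x) δ hδ
  have hzsa : IsSelfAdjoint (z : A) := z.2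
  have hne : ∀ t ∈ spectrum ℝ (z : A), t / δ ≠ ⌊t / δ⌋ := by
    intro t ht hfl
    have h1 := hz ⌊t / δ⌋
    rw [← hfl, mul_div_cancel₀ t hδ.ne', ← IsUnit.neg_iff, neg_sub] at h1
    exact ht h1
  -- `g` moves each `t` to the point with fractional part `r` in its own cell of the lattice `δ ℤ`.
  -- It jumps only at lattice points, which the spectrum of `z` avoids.
  let g : ℝ → ℝ := fun t => t + δ * (r - Int.fract (t / δ))
  have hg : ContinuousOn g (spectrum ℝ (z : A)) := by
    intro t ht
    have h1 : ContinuousAt (fun t : ℝ => Int.fract (t / δ)) t :=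
      ContinuousAt.comp (f := fun t : ℝ => t / δ) (continuousAt_fract (hne t ht)) (by fun_prop)
    exact (continuousAt_id.add (continuousAt_const.mul
      (continuousAt_const.sub h1))).continuousWithinAt
  refine ⟨⟨cfc g (z : A), cfc_predicate _ _⟩, ?_, ?_⟩
  · have hzy : ‖(z : A) - cfc g (z : A)‖ ≤ δ := by
      nth_rw 1 [← cfc_id' ℝ (z : A) hzsa]
      rw [← cfc_sub _ _ (z : A)]
      refine norm_cfc_le hδ.le fun t _ => ?_
      have h0 := Int.fract_nonneg (t / δ)
      have h1 := Int.fract_lt_one (t / δ)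
      rw [Real.norm_eq_abs, show t - g t = δ * (Int.fract (t / δ) - r) by simp only [g]; ring,
        abs_mul, abs_of_pos hδ]
      exact mul_le_of_le_one_right hδ.le (abs_le.2 ⟨by linarith, by linarith⟩)
    refine (dist_triangle x z _).trans_lt ?_
    rw [two_mul]
    refine add_lt_add_of_lt_of_le hxz ?_
    rw [Subtype.dist_eq, dist_eq_norm]
    exact hzy
  · intro t ht
    change t ∈ spectrum ℝ (cfc g (z : A)) at ht
    rw [cfc_map_spectrum g (z : A) hzsa hg] at ht
    obtain ⟨s, -, rfl⟩ := ht
    have : g s / δ = ⌊s / δ⌋ + r := by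
      have := Int.self_sub_fract (s / δ)
      rw [← this]
      simp only [g]
      field_simp
      ring
    rw [this, Int.fract_intCast_add, Int.fract_eq_self.2 ⟨hr0, hr1⟩]

/-- The spectra of the entries are pairwise disjoint and do not contain zero. -/
def SeparatedSpectra {n : ℕ} (d : Fin n → selfAdjoint A) : Prop :=
  (∀ i, (0 : ℝ) ∉ spectrum ℝ (d i : A)) ∧
    Pairwise fun i j => Disjoint (spectrum ℝ (d i : A)) (spectrum ℝ (d j : A))

theorem dense_separatedSpectra (h : Dense {x : selfAdjoint A | IsUnit (x : A)}) (n : ℕ) :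
    Dense {d : Fin n → selfAdjoint A | SeparatedSpectra d} := by
  intro d
  refine Metric.mem_closure_iff.2 fun ε hε => ?_
  have hlt : ∀ i : Fin n, ((i : ℝ) + 1) / (n + 1) < 1 := by
    intro i
    rw [div_lt_one (by positivity)]
    have : (i : ℝ) < n := by exact_mod_cast i.2
    linarith
  -- The residues `(i + 1) / (n + 1)` are distinct and lie strictly between 0 and 1, so the
  -- translated lattices are disjoint and miss zero.
  choose y hy hyr using fun i : Fin n => exists_fract_eq_of_dense h (d i)
    (δ := ε / 2) (by positivity) (r := ((i : ℝ) + 1) / (n + 1)) (by positivity) (hlt i)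
  refine ⟨y, ⟨fun i h0 => ?_, fun i j hij => ?_⟩, ?_⟩
  · have h1 := hyr i 0 h0
    rw [zero_div, Int.fract_zero] at h1
    have : (0 : ℝ) < ((i : ℝ) + 1) / (n + 1) := by positivity
    exact this.ne h1
  · refine Set.disjoint_left.2 fun t hi hj => ?_
    have h1 := (hyr i t hi).symm.trans (hyr j t hj)
    rw [div_left_inj' (by positivity), add_left_inj] at h1
    exact hij (Fin.ext (by exact_mod_cast h1))
  · refine (dist_pi_lt_iff hε).2 fun i => ?_
    have := hy i
    rwa [mul_div_cancel₀ ε two_ne_zero] at this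

end RealRank

section StableRank

theorem dense_isUnit (h : stableRank A = 1) : Dense {x : A | IsUnit x} := by
  have hd : Dense (lg A 1) := by
    by_contra hd
    have : (2 : ℕ∞) ≤ stableRank A := by
      refine le_iInf fun k => le_iInf₂ fun hk hk' => ?_
      have : 2 ≤ k := by
        by_contra hlt
        obtain rfl : k = 1 := by omega
        exact hd hk'
      exact_mod_cast this
    rw [h] at this
    exact absurd this (by decide)
  -- The definition of stable rank gives only left invertible elements.
  have hl : ∀ x : A, x ∈ closure {y : A | ∃ z, z * y = 1} := by
    intro x
    refine map_mem_closure (f := fun a : Fin 1 → A => a 0) (by fun_prop) (hd fun _ => x) ?_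
    intro a ha
    have ha' : IsUnit (∑ i, star (a i) * a i) := ha
    simp only [Finset.univ_unique, Fin.default_eq_zero, Finset.sum_singleton] at ha'
    exact ⟨Ring.inverse (star (a 0) * a 0) * star (a 0), by
      rw [mul_assoc, Ring.inverse_mul_cancel _ ha']⟩
  intro x
  refine closure_mono ?_ (hl x)
  rintro y ⟨z, hzy⟩
  -- A left inverse `z` of `y` is perturbed to a left invertible `z'` with `z' * y` still a unit.
  -- Then `z'` is invertible on both sides, and hence so is `y`.
  have hopen : {z' : A | IsUnit (z' * y)} ∈ 𝓝 z :=
    (Units.isOpen.preimage (f := fun z' : A => z' * y) (by fun_prop)).mem_nhds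
      (by change IsUnit (z * y); rw [hzy]; exact isUnit_one)
  obtain ⟨z', hz'u, w, hw⟩ := mem_closure_iff_nhds.1 (hl z) _ hopen
  have hz'u : IsUnit (z' * y) := hz'u
  have hz' : IsUnit z' := by
    refine isUnit_iff_exists.2 ⟨w, ?_, hw⟩
    have h1 : z' * (y * Ring.inverse (z' * y)) = 1 := by
      rw [← mul_assoc, Ring.mul_inverse_cancel _ hz'u]
    rw [left_inv_eq_right_inv hw h1, h1]
  obtain ⟨v, rfl⟩ := hz'
  exact (Units.isUnit_units_mul v y).1 hz'u

end StableRank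

section GeneratorRank

/-- Enlarging a generating tuple keeps it generating, so only `k + 1` of the entries are perturbed
and the rest are left alone. An arbitrary index type accommodates the matrix parameters. -/
theorem dense_generating (ι : Type*) [Fintype ι] {N : ℕ} (hN : N + 1 ≤ Fintype.card ι)
    (h : generatorRank A ≤ N) :
    Dense {c : ι → selfAdjoint A | (NonUnitalStarAlgebra.adjoin ℂ
      (Set.range fun i => (c i : A))).topologicalClosure = ⊤} := by
  classical
  obtain ⟨k, hk, hd⟩ : ∃ k ≤ N, Dense (genSA A (k + 1)) := by
    by_contra! hcon
    have : ((N + 1 : ℕ) : ℕ∞) ≤ generatorRank A := by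
      refine le_iInf₂ fun k hk => ?_
      by_contra hlt
      exact hcon k (by simp only [Nat.cast_le, not_le] at hlt; omega) hk
    have := this.trans h
    simp only [Nat.cast_le] at this
    omega
  obtain ⟨σ⟩ : Nonempty (Fin (k + 1) ↪ ι) :=
    Function.Embedding.nonempty_of_card_le (by rw [Fintype.card_fin]; omega)
  intro c
  let f : (Fin (k + 1) → selfAdjoint A) → ι → selfAdjoint A := fun b => Function.extend σ b c
  have hf : Continuous f := by
    refine continuous_pi fun i => ?_
    by_cases hi : ∃ j, σ j = i
    · obtain ⟨j, rfl⟩ := hi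
      simp only [f, σ.injective.extend_apply]
      exact continuous_apply j
    · simp only [f, Function.extend_apply' _ _ _ hi]
      exact continuous_const
  have hfc : f (c ∘ σ) = c := by
    funext i
    by_cases hi : ∃ j, σ j = i
    · obtain ⟨j, rfl⟩ := hi
      simp only [f, σ.injective.extend_apply, Function.comp]
    · simp only [f, Function.extend_apply' _ _ _ hi]
  rw [← hfc]
  refine map_mem_closure hf (hd (c ∘ σ)) fun b hb => ?_
  have hb' : (NonUnitalStarAlgebra.adjoin ℂ
      (Set.range fun i => (b i : A))).topologicalClosure = ⊤ := hb
  refine top_le_iff.1 ?_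
  rw [← hb']
  refine NonUnitalStarSubalgebra.topologicalClosure_mono
    (NonUnitalStarAlgebra.adjoin_mono ?_)
  rintro _ ⟨j, rfl⟩
  exact ⟨σ j, by simp only [f, σ.injective.extend_apply]⟩

end GeneratorRank

/-- Pairwise disjoint compact sets, finitely many, have pairwise disjoint open neighbourhoods. -/
theorem exists_open_pairwise_disjoint {X ι : Type*} [TopologicalSpace X] [T2Space X] [Finite ι]
    {K : ι → Set X} (hK : ∀ i, IsCompact (K i)) (hd : Pairwise fun i j => Disjoint (K i) (K j)) :
    ∃ V : ι → Set X, (∀ i, IsOpen (V i)) ∧ (∀ i, K i ⊆ V i) ∧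
      Pairwise fun i j => Disjoint (V i) (V j) := by
  have hsep : ∀ i j, i ≠ j → ∃ U W : Set X, IsOpen U ∧ IsOpen W ∧ K i ⊆ U ∧ K j ⊆ W ∧
      Disjoint U W := fun i j hij => SeparatedNhds.of_isCompact_isCompact (hK i) (hK j) (hd hij)
  choose! U W hU hW hKU hKW hUW using hsep
  -- The separation of `i, j` and that of `j, i` are chosen independently, so each neighbourhood
  -- intersects both choices.
  refine ⟨fun i => ⋂ j ∈ {j | i ≠ j}, U i j ∩ W j i, fun i => ?_, fun i => ?_, fun i j hij => ?_⟩
  · exact (Set.toFinite _).isOpen_biInter fun j hj => (hU i j hj).inter (hW j i (Ne.symm hj))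
  · exact Set.subset_iInter₂ fun j hj =>
      Set.subset_inter (hKU i j hj) (hKW j i (Ne.symm hj))
  · refine (hUW i j hij).mono ?_ ?_
    · exact (Set.biInter_subset_of_mem (show j ∈ {j | i ≠ j} from hij)).trans
        Set.inter_subset_left
    · exact (Set.biInter_subset_of_mem (show i ∈ {i | j ≠ i} from hij.symm)).trans
        Set.inter_subset_right

end CStarRank

/-! ### Matrix units, diagonal matrices and a generation criterion -/

namespace CStarRank

open Filter Topology CStarMatrix

section Algebra

variable {A : Type*} [CStarAlgebra A] {m : Type*}

theorem continuous_matrix_mk {X : Type*} [TopologicalSpace X] {f : X → CStarMatrix m m A}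
    (h : ∀ i j, Continuous fun x => f x i j) : Continuous f :=
  continuous_pi fun i => continuous_pi fun j => h i j

variable [DecidableEq m]

/-- The matrix with the single entry `x` in position `(i, j)`. -/
def unitMat (i j : m) (x : A) : CStarMatrix m m A := ofMatrix (Matrix.single i j x)

theorem unitMat_apply (i j k l : m) (x : A) :
    unitMat i j x k l = if i = k ∧ j = l then x else 0 := rfl

theorem star_unitMat (i j : m) (x : A) : star (unitMat i j x) = unitMat j i (star x) := by
  ext k l
  rw [CStarMatrix.star_apply, unitMat_apply, unitMat_apply]
  simp only [and_comm]
  split_ifs <;> simp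

theorem continuous_unitMat (i j : m) : Continuous (unitMat i j : A → CStarMatrix m m A) := by
  refine continuous_matrix_mk fun k l => ?_
  simp only [unitMat_apply]
  split_ifs
  · exact continuous_id
  · exact continuous_const

variable [Fintype m]

theorem unitMat_mul_unitMat (i j k : m) (x y : A) :
    unitMat i j x * unitMat j k y = unitMat i k (x * y) :=
  Matrix.single_mul_single_same (α := A) (c := x) i j k y

theorem unitMat_mul_unitMat_of_ne (i : m) {j k : m} (l : m) (h : j ≠ k) (x y : A) :
    unitMat i j x * unitMat k l y = 0 :=
  Matrix.single_mul_single_of_ne (α := A) (c := x) i j k h y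

theorem unitMat_mul_mul_unitMat (i j k l : m) (x y : A) (b : CStarMatrix m m A) :
    unitMat i j x * b * unitMat k l y = unitMat i l (x * b j k * y) :=
  Matrix.single_mul_mul_single i j k l x b y

theorem eq_sum_unitMat (b : CStarMatrix m m A) : b = ∑ i, ∑ j, unitMat i j (b i j) :=
  Matrix.matrix_eq_sum_single b

/-- The embedding of `A` as a diagonal corner. -/
def cornerHom (i : m) : A →⋆ₙₐ[ℂ] CStarMatrix m m A where
  toFun := unitMat i i
  map_smul' c x := (Matrix.smul_single c i i x).symm
  map_zero' := Matrix.single_zero i i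
  map_add' x y := Matrix.single_add i i x y
  map_mul' x y := (unitMat_mul_unitMat i i i x y).symm
  map_star' x := (star_unitMat i i x).symm

/-- The embedding of tuples as diagonal matrices. -/
def diagHom : (m → A) →⋆ₐ[ℂ] CStarMatrix m m A where
  toFun d := ofMatrix (Matrix.diagonal d)
  map_one' := Matrix.diagonal_one
  map_zero' := Matrix.diagonal_zero
  map_add' x y := (Matrix.diagonal_add x y).symm
  map_mul' x y := (Matrix.diagonal_mul_diagonal x y).symm
  commutes' c := by
    ext i j
    rw [CStarMatrix.algebraMap_apply]
    simp [Matrix.diagonal_apply]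
  map_star' d := by
    ext i j
    rw [CStarMatrix.star_apply]
    rcases eq_or_ne i j with rfl | h
    · simp
    · simp [h, h.symm]

theorem diagHom_apply (d : m → A) (i j : m) : diagHom d i j = if i = j then d i else 0 :=
  Matrix.diagonal_apply d i j

theorem diagHom_apply_eq (d : m → A) (i : m) : diagHom d i i = d i := by
  rw [diagHom_apply, if_pos rfl]

theorem diagHom_mul_apply (d : m → A) (b : CStarMatrix m m A) (i j : m) :
    (diagHom d * b) i j = d i * b i j :=
  Matrix.diagonal_mul d b i j

theorem mul_diagHom_apply (d : m → A) (b : CStarMatrix m m A) (i j : m) :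
    (b * diagHom d) i j = b i j * d j :=
  Matrix.mul_diagonal d b i j

theorem diagHom_single (i : m) : diagHom (Pi.single i (1 : A)) = unitMat i i 1 := by
  ext k l
  rw [diagHom_apply, unitMat_apply]
  by_cases h : i = k
  · subst h; simp
  · simp [h, Ne.symm h]

theorem mem_centralizer_range_unitMat {x : CStarMatrix m m A} :
    x ∈ StarSubalgebra.centralizer ℂ (Set.range fun i : m => unitMat i i (1 : A)) ↔
      x = diagHom fun i => x i i := by
  simp only [StarSubalgebra.mem_centralizer_iff, Set.forall_mem_range, star_unitMat, star_one,
    and_self]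
  simp only [← diagHom_single]
  constructor
  · intro h
    ext i j
    rw [diagHom_apply]
    split_ifs with hij
    · rw [hij]
    · have := congrFun (congrFun (h i) i) j
      rw [diagHom_mul_apply, mul_diagHom_apply] at this
      simpa [Pi.single_apply, Ne.symm hij] using this
  · intro h i
    rw [h, ← map_mul, ← map_mul]
    congr 1
    funext j
    simp [Pi.single_apply]

theorem isStarProjection_unitMat (i : m) : IsStarProjection (unitMat i i (1 : A)) :=
  ⟨by rw [IsIdempotentElem, unitMat_mul_unitMat, one_mul],
    by rw [isSelfAdjoint_iff, star_unitMat, star_one]⟩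

theorem unitMat_commute (i j : m) :
    unitMat i i (1 : A) * unitMat j j 1 = unitMat j j 1 * unitMat i i 1 := by
  rcases eq_or_ne i j with rfl | h
  · rfl
  · rw [unitMat_mul_unitMat_of_ne _ _ h, unitMat_mul_unitMat_of_ne _ _ h.symm]

theorem continuous_diagHom : Continuous (diagHom : (m → A) → CStarMatrix m m A) := by
  refine continuous_matrix_mk fun i j => ?_
  simp only [diagHom_apply]
  split_ifs
  · exact continuous_apply i
  · exact continuous_const

end Algebra

variable {A : Type*} [CStarAlgebra A] [PartialOrder A] [StarOrderedRing A]
  {m : Type*} [Fintype m] [DecidableEq m]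

/-- This commutant is the algebra of diagonal matrices, where the units can be approximated entry by
entry. -/
theorem selfAdjointUnitsDense_centralizer_unitMat (h : Dense {x : selfAdjoint A | IsUnit (x : A)}) :
    SelfAdjointUnitsDense
      (StarSubalgebra.centralizer ℂ (Set.range fun i : m => unitMat i i (1 : A))) := by
  intro x hx hxsa
  rw [mem_centralizer_range_unitMat] at hx
  have hsa : ∀ i, IsSelfAdjoint (x i i) := fun i => by
    rw [isSelfAdjoint_iff, ← CStarMatrix.star_apply, hxsa.star_eq]
  let f : (m → selfAdjoint A) → CStarMatrix m m A := fun d => diagHom fun i => (d i : A)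
  have hf : Continuous f := continuous_diagHom.comp (by fun_prop)
  have hfx : f (fun i => ⟨x i i, hsa i⟩) = x := hx.symm
  rw [← hfx]
  have hd : Dense (Set.univ.pi fun _ : m => {x : selfAdjoint A | IsUnit (x : A)}) :=
    dense_pi Set.univ fun _ _ => h
  refine map_mem_closure hf (hd _) fun d hd' => ⟨?_, ?_, ?_⟩
  · rw [mem_centralizer_range_unitMat]
    simp only [f, diagHom_apply_eq]
  · rw [isSelfAdjoint_iff]
    simp only [f, ← map_star]
    congr 1
    funext i
    exact (d i).2
  · exact IsUnit.map diagHom (Pi.isUnit_iff.2 fun i => hd' i trivial)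

/-- Self-adjoint matrices over an algebra of real rank zero are approximately diagonalizable. -/
theorem exists_unitary_norm_conj_sub_diag_lt (h : Dense {x : selfAdjoint A | IsUnit (x : A)})
    {a : CStarMatrix m m A} (ha : IsSelfAdjoint a) {ε : ℝ} (hε : 0 < ε) :
    ∃ u ∈ unitary (CStarMatrix m m A), ∃ d : m → selfAdjoint A,
      ‖star u * a * u - diagHom fun i => (d i : A)‖ < ε := by
  obtain ⟨u, hu, d, hd, hdsa, hlt⟩ := exists_unitary_norm_conj_sub_lt
    (isStarProjection_unitMat (A := A) (m := m)) unitMat_commute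
    (selfAdjointUnitsDense_centralizer_unitMat h) ha hε
  rw [mem_centralizer_range_unitMat] at hd
  refine ⟨u, hu, fun i => ⟨d i i, ?_⟩, ?_⟩
  · rw [selfAdjoint.mem_iff, ← CStarMatrix.star_apply, hdsa.star_eq]
  · change ‖star u * a * u - diagHom fun i => d i i‖ < ε
    rwa [← hd]

/-- A closed subalgebra containing the image of a tuple whose entries have spectra in disjoint open
sets away from zero contains the images of the standard projections. -/
theorem map_single_mem {A : Type*} [CStarAlgebra A] {B : Type*} [CStarAlgebra B]
    {φ : (m → A) →⋆ₐ[ℂ] B} (hφ : Continuous φ) {S : NonUnitalStarSubalgebra ℂ B}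
    [IsClosed (S : Set B)] {d : m → A} (hd : ∀ i, IsSelfAdjoint (d i))
    {V : Option m → Set ℝ} (hV : ∀ o, IsOpen (V o)) (h0 : (0 : ℝ) ∈ V none)
    (hdV : ∀ i, spectrum ℝ (d i) ⊆ V (some i))
    (hdisj : Pairwise fun o o' => Disjoint (V o) (V o')) (hS : φ d ∈ S) (i : m) :
    φ (Pi.single i 1) ∈ S := by
  classical
  -- Locally constant on the union of the disjoint open sets, and zero at `0`, so the non-unital
  -- calculus applies and stays in `S`.
  let f : ℝ → ℝ := (V (some i)).indicator 1
  have hval : ∀ o, ∀ t ∈ V o, f t = if o = some i then 1 else 0 := by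
    intro o t ht
    split_ifs with ho
    · subst ho
      exact Set.indicator_of_mem ht _
    · exact Set.indicator_of_notMem (fun h => Set.disjoint_left.1 (hdisj ho) ht h) _
  have hf0 : f 0 = 0 := by rw [hval none 0 h0, if_neg (by simp)]
  have hcont : ContinuousOn f (⋃ o, V o) := by
    intro t ht
    obtain ⟨o, ho⟩ := Set.mem_iUnion.1 ht
    refine ContinuousAt.continuousWithinAt ?_
    exact (continuousAt_const (y := if o = some i then (1 : ℝ) else 0)).congr
      (((hV o).mem_nhds ho |> Filter.mem_of_superset) fun s hs => (hval o s hs).symm)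
  have hspec : ∀ k, quasispectrum ℝ (d k) ⊆ ⋃ o, V o := by
    intro k t ht
    rw [quasispectrum_eq_spectrum_union_zero] at ht
    rcases ht with ht | rfl
    · exact Set.mem_iUnion.2 ⟨_, hdV k ht⟩
    · exact Set.mem_iUnion.2 ⟨_, h0⟩
  have hdsa : IsSelfAdjoint d := funext hd
  have hne : Nonempty m := ⟨i⟩
  have hcd : ContinuousOn f (⋃ k, quasispectrum ℝ (d k)) := hcont.mono (Set.iUnion_subset hspec)
  have hpi : cfcₙ f d = Pi.single i 1 := by
    rw [cfcₙ_map_pi (S := ℂ) f d hcd hdsa hd]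
    funext k
    have hq := hcont.mono (hspec k)
    rw [cfcₙ_eq_cfc (hf := hq) (hf0 := hf0)]
    rw [cfc_congr (g := fun _ => if k = i then 1 else 0)
      (fun t ht => by rw [hval _ t (hdV k ht)]; simp)]
    rw [cfc_const _ _ (hd k), Pi.single_apply]
    split_ifs <;> simp
  have hmap : φ (cfcₙ f d) = cfcₙ f (φ d) :=
    NonUnitalStarAlgHomClass.map_cfcₙ (S := ℂ) φ f d
      (by rwa [Pi.quasispectrum_eq]) hf0 hφ hdsa (hdsa.map φ)
  rw [← hpi, hmap]
  exact cfcₙ_mem f hS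

/-- A closed subalgebra with the diagonal matrix units and an invertible positive entry in every
position of one row is everything as soon as its entries generate `A`. -/
theorem eq_top_of_entries {S : NonUnitalStarSubalgebra ℂ (CStarMatrix m m A)}
    [hS : IsClosed (S : Set (CStarMatrix m m A))] (i₀ : m) (hdiag : ∀ i, unitMat i i (1 : A) ∈ S)
    (hrow : ∀ j ≠ i₀, ∃ b ∈ S, IsUnit (b i₀ j) ∧ 0 ≤ b i₀ j)
    (hT : ∀ T : NonUnitalStarSubalgebra ℂ A, IsClosed (T : Set A) → (1 : A) ∈ T →
      (∀ b ∈ S, ∀ i j, b i j ∈ T) → T = ⊤) : S = ⊤ := by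
  let T : NonUnitalStarSubalgebra ℂ A := S.comap (cornerHom i₀)
  have hTmem : ∀ x, x ∈ T ↔ unitMat i₀ i₀ x ∈ S := fun x => Iff.rfl
  have hTc : IsClosed (T : Set A) := hS.preimage (continuous_unitMat i₀ i₀)
  have h1T : (1 : A) ∈ T := hdiag i₀
  have hentry : ∀ b ∈ S, ∀ i j, unitMat i j (b i j) ∈ S := by
    intro b hb i j
    have := S.mul_mem (S.mul_mem (hdiag i) hb) (hdiag j)
    rwa [unitMat_mul_mul_unitMat, one_mul, mul_one] at this
  have hrowS : ∀ j, unitMat i₀ j (1 : A) ∈ S := by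
    intro j
    rcases eq_or_ne j i₀ with rfl | hj
    · exact hdiag j
    · obtain ⟨b, hb, hu, hpos⟩ := hrow j hj
      set x := b i₀ j
      have hx : unitMat i₀ j x ∈ S := hentry b hb i₀ j
      have hxsa : star x = x := IsSelfAdjoint.of_nonneg hpos
      have hxx : x * x ∈ T := by
        have hx' : star (unitMat i₀ j x) ∈ S := star_mem hx
        have := S.mul_mem hx hx'
        rwa [star_unitMat, unitMat_mul_unitMat, hxsa] at this
      -- The corner directly contains only `x * x`; positivity recovers `x` as its square root.
      -- Multiplying by `x⁻¹` then turns the entry into a matrix unit.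
      have hxT : x ∈ T := by
        have : cfcₙ Real.sqrt (x * x) = x := by
          rw [← CFC.sqrt_eq_real_sqrt (x * x) (by
            have := star_mul_self_nonneg x
            rwa [hxsa] at this), CFC.sqrt_mul_self x hpos]
        rw [← this]
        exact cfcₙ_mem Real.sqrt hxx
      let T' : StarSubalgebra ℂ A := T.toStarSubalgebra h1T
      have hT'c : IsClosed (T' : Set A) := hTc
      have hinv : Ring.inverse x ∈ T := inverse_mem_of_isClosed (S := T') (x := x) hxT
      have := S.mul_mem ((hTmem _).1 hinv) hx
      rwa [unitMat_mul_unitMat, Ring.inverse_mul_cancel _ hu] at this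
  have hcol : ∀ j, unitMat j i₀ (1 : A) ∈ S := by
    intro j
    have := star_mem (hrowS j)
    rwa [star_unitMat, star_one] at this
  have hTtop : T = ⊤ := by
    refine hT T hTc h1T fun b hb i j => (hTmem _).2 ?_
    have := S.mul_mem (S.mul_mem (hrowS i) hb) (hcol j)
    rwa [unitMat_mul_mul_unitMat, one_mul, mul_one] at this
  refine NonUnitalStarAlgebra.eq_top_iff.2 fun b => ?_
  rw [eq_sum_unitMat b]
  refine sum_mem fun i _ => sum_mem fun j _ => ?_
  have hb : b i j ∈ T := hTtop ▸ NonUnitalStarAlgebra.mem_top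
  have := S.mul_mem (S.mul_mem (hcol i) ((hTmem _).1 hb)) (hrowS j)
  rwa [unitMat_mul_unitMat, unitMat_mul_unitMat, one_mul, mul_one] at this

end CStarRank

/-! ### Polar decomposition and unitary conjugation -/

namespace CStarRank

open Filter Topology CStarMatrix

section Spectrum

variable {A : Type*} [CStarAlgebra A]

theorem eventually_spectrum_subset {x : A} {U : Set ℝ} (hU : IsOpen U)
    (h : spectrum ℝ x ⊆ U) : ∀ᶠ y in 𝓝 x, spectrum ℝ y ⊆ U :=
  upperHemicontinuousAt_iff_forall_isOpen.1
    ((upperHemicontinuous_spectrum ℝ A).upperHemicontinuousAt x) U hU h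

/-- Polar decomposition: `v = x⁻¹ (x x*)^{1/2}` is unitary, and `x v` is the invertible positive
square root. -/
theorem exists_unitary_spectrum_mul_subset [PartialOrder A] [StarOrderedRing A] {x : A}
    (hx : IsUnit x) : ∃ v ∈ unitary A, IsSelfAdjoint (x * v) ∧ spectrum ℝ (x * v) ⊆ Set.Ioi 0 := by
  have h0 : 0 ≤ x * star x := mul_star_self_nonneg x
  set y := CFC.sqrt (x * star x)
  have hyy : y * y = x * star x := CFC.sqrt_mul_sqrt_self _ h0
  have hy0 : 0 ≤ y := CFC.sqrt_nonneg _
  have hysa : star y = y := IsSelfAdjoint.of_nonneg hy0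
  have hyu : IsUnit y := by
    have : IsUnit (y * y) := hyy ▸ hx.mul hx.star
    exact ((Commute.refl y).isUnit_mul_iff.1 this).1
  obtain ⟨w, rfl⟩ := hx
  have hv : (w⁻¹ : Aˣ).1 * y * star ((w⁻¹ : Aˣ).1 * y) = 1 := by
    have h1 : star (w : A) * star (w⁻¹ : Aˣ).1 = 1 := by rw [← star_mul, w.inv_mul, star_one]
    calc (w⁻¹ : Aˣ).1 * y * star ((w⁻¹ : Aˣ).1 * y)
        = (w⁻¹ : Aˣ).1 * (y * y) * star (w⁻¹ : Aˣ).1 := by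
          rw [star_mul, hysa]; simp only [mul_assoc]
      _ = ((w⁻¹ : Aˣ).1 * w) * (star (w : A) * star (w⁻¹ : Aˣ).1) := by
          rw [hyy]; simp only [mul_assoc]
      _ = 1 := by rw [h1, w.inv_mul, mul_one]
  have hwy : (w : A) * ((w⁻¹ : Aˣ).1 * y) = y := by rw [← mul_assoc, w.mul_inv, one_mul]
  refine ⟨(w⁻¹ : Aˣ).1 * y, ?_, ?_, ?_⟩
  · obtain ⟨v, hv'⟩ := (w⁻¹).isUnit.mul hyu
    rw [← hv'] at hv ⊢
    refine ⟨?_, hv⟩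
    rw [← Units.inv_eq_of_mul_eq_one_right hv, v.inv_mul]
  · rw [hwy]; exact hysa
  · rw [hwy]
    intro t ht
    exact lt_of_le_of_ne (spectrum_nonneg_of_nonneg hy0 ht) (spectrum_ne_zero_of_isUnit hyu ht).symm

end Spectrum

section Conjugation

variable {B : Type*} [CStarAlgebra B]

/-- Conjugation by a fixed element, on self-adjoint elements. -/
def conjSA (u : B) (a : selfAdjoint B) : selfAdjoint B :=
  ⟨u * a * star u, a.2.conjugate u⟩

theorem continuous_conjSA (u : B) : Continuous (conjSA u) := by
  unfold conjSA
  fun_prop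

theorem conjSA_conjSA_star {u : B} (hu : u ∈ unitary B) (a : selfAdjoint B) :
    conjSA u (conjSA (star u) a) = a := by
  have huu : u * star u = 1 := hu.2
  ext
  calc u * (star u * a * star (star u)) * star u = (u * star u) * a * (u * star u) := by
        rw [star_star]; simp only [mul_assoc]
    _ = a := by rw [huu]; simp

theorem conjSA_mem_genSA {u : B} (hu : u ∈ unitary B) {k : ℕ} {a : Fin k → selfAdjoint B}
    (ha : a ∈ genSA B k) : (fun i => conjSA u (a i)) ∈ genSA B k := by
  let φ : B ≃⋆ₐ[ℂ] B := Unitary.conjStarAlgAut ℂ B ⟨u, hu⟩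
  have hφ : ∀ x, φ x = u * x * star u := fun x => Unitary.conjStarAlgAut_apply _ _
  have hφc : Continuous φ := by simp only [funext hφ]; fun_prop
  set S := generatedSubalgebra fun i => (conjSA u (a i) : B)
  have hS : IsClosed (S : Set B) := NonUnitalStarSubalgebra.isClosed_topologicalClosure _
  have hle : generatedSubalgebra (fun i => (a i : B)) ≤ S.comap (φ : B →⋆ₙₐ[ℂ] B) := by
    refine NonUnitalStarSubalgebra.topologicalClosure_minimal _
      (NonUnitalStarAlgebra.adjoin_le ?_) (hS.preimage hφc)
    rintro _ ⟨i, rfl⟩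
    change φ (a i) ∈ S
    rw [hφ]
    exact NonUnitalStarSubalgebra.le_topologicalClosure _
      (NonUnitalStarAlgebra.subset_adjoin ℂ _ ⟨i, rfl⟩)
  have htop : generatedSubalgebra (fun i => (a i : B)) = ⊤ := ha
  rw [htop] at hle
  refine NonUnitalStarAlgebra.eq_top_iff.2 fun x => ?_
  have : φ (φ.symm x) ∈ S := hle (NonUnitalStarAlgebra.mem_top (x := φ.symm x))
  rwa [φ.apply_symm_apply] at this

theorem conjSA_mem_closure_genSA {u : B} (hu : u ∈ unitary B) {k : ℕ} {a : Fin k → selfAdjoint B}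
    (ha : a ∈ closure (genSA B k)) : (fun i => conjSA u (a i)) ∈ closure (genSA B k) :=
  map_mem_closure (f := fun (a : Fin k → selfAdjoint B) i => conjSA u (a i))
    (continuous_pi fun i => (continuous_conjSA u).comp (continuous_apply i)) ha
    fun _ h => conjSA_mem_genSA hu h

end Conjugation

/-! ### Parametrization of the normal form by self-adjoint elements -/

section Parameters

variable {A : Type*} [CStarAlgebra A] {p q : ℕ}

/-- The diagonal entries of the first matrix of the parametrized tuple. -/
def paramDiag (c : Option (Fin (q + 1) × Fin (p + 1) × Fin (p + 1)) → selfAdjoint A)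
    (i : Fin (p + 1)) : selfAdjoint A :=
  if i = 0 then c none else c (some (0, i, 0))

/-- The entries above the diagonal of the other matrices. The first row of the second matrix is
self-adjoint; the parameters freed this way are used for the diagonal of the first matrix. -/
def paramUpper (c : Option (Fin (q + 1) × Fin (p + 1) × Fin (p + 1)) → selfAdjoint A)
    (r : Fin (q + 1)) (i j : Fin (p + 1)) : A :=
  c (some (r, i, j)) + Complex.I • (if r = 0 ∧ i = 0 then 0 else (c (some (r, j, i)) : A))

/-- The entries of the matrices after the first. -/
def paramEntry (c : Option (Fin (q + 1) × Fin (p + 1) × Fin (p + 1)) → selfAdjoint A)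
    (r : Fin (q + 1)) (i j : Fin (p + 1)) : A :=
  if i < j then paramUpper c r i j else if j < i then star (paramUpper c r j i)
    else c (some (r, i, i))

theorem star_paramEntry (c : Option (Fin (q + 1) × Fin (p + 1) × Fin (p + 1)) → selfAdjoint A)
    (r : Fin (q + 1)) (i j : Fin (p + 1)) : star (paramEntry c r i j) = paramEntry c r j i := by
  unfold paramEntry
  rcases lt_trichotomy i j with h | h | h
  · rw [if_pos h, if_neg h.not_gt, if_pos h]
  · subst h
    simp only [lt_irrefl, if_false]
    exact (c _).2
  · rw [if_neg h.not_gt, if_pos h, if_pos h, star_star]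

/-- Tuples of self-adjoint matrices, the first one diagonal, built from self-adjoint parameters. -/
def paramTuple (c : Option (Fin (q + 1) × Fin (p + 1) × Fin (p + 1)) → selfAdjoint A) :
    Fin (q + 2) → selfAdjoint (CStarMatrix (Fin (p + 1)) (Fin (p + 1)) A) :=
  Fin.cons ⟨diagHom fun i => (paramDiag c i : A), by
      rw [selfAdjoint.mem_iff, ← map_star]
      congr 1
      funext i
      exact (paramDiag c i).2⟩
    fun r => ⟨ofMatrix (paramEntry c r), by
      rw [selfAdjoint.mem_iff]
      ext i j
      rw [CStarMatrix.star_apply]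
      exact star_paramEntry c r j i⟩

theorem paramTuple_zero (c : Option (Fin (q + 1) × Fin (p + 1) × Fin (p + 1)) → selfAdjoint A) :
    (paramTuple c 0 : CStarMatrix (Fin (p + 1)) (Fin (p + 1)) A) =
      diagHom fun i => (paramDiag c i : A) := rfl

theorem paramTuple_succ_apply
    (c : Option (Fin (q + 1) × Fin (p + 1) × Fin (p + 1)) → selfAdjoint A) (r : Fin (q + 1))
    (i j : Fin (p + 1)) :
    (paramTuple c r.succ : CStarMatrix (Fin (p + 1)) (Fin (p + 1)) A) i j = paramEntry c r i j :=
  rfl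

theorem continuous_paramDiag (i : Fin (p + 1)) :
    Continuous fun c : Option (Fin (q + 1) × Fin (p + 1) × Fin (p + 1)) → selfAdjoint A =>
      (paramDiag c i : A) := by
  unfold paramDiag
  split_ifs <;> fun_prop

theorem continuous_paramUpper (r : Fin (q + 1)) (i j : Fin (p + 1)) :
    Continuous fun c : Option (Fin (q + 1) × Fin (p + 1) × Fin (p + 1)) → selfAdjoint A =>
      paramUpper c r i j := by
  unfold paramUpper
  split_ifs <;> fun_prop

theorem continuous_paramTuple :
    Continuous (paramTuple (A := A) (p := p) (q := q)) := by
  refine continuous_pi fun s => continuous_induced_rng.2 ?_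
  refine Fin.cases ?_ (fun r => ?_) s
  · simp only [Function.comp_def, paramTuple_zero]
    exact continuous_diagHom.comp (continuous_pi continuous_paramDiag)
  · refine continuous_matrix_mk fun i j => ?_
    simp only [Function.comp_def, paramTuple_succ_apply, paramEntry]
    split_ifs
    · exact continuous_paramUpper r i j
    · exact (continuous_paramUpper r j i).star
    · fun_prop

/-- The parameters can be recovered from the entries. -/
theorem param_mem {c : Option (Fin (q + 1) × Fin (p + 1) × Fin (p + 1)) → selfAdjoint A}
    {T : NonUnitalStarSubalgebra ℂ A} (hdiag : ∀ i, (paramDiag c i : A) ∈ T)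
    (hentry : ∀ r i j, paramEntry c r i j ∈ T) (o) : (c o : A) ∈ T := by
  -- A star-closed subspace contains the real and imaginary parts of its elements.
  have hre : ∀ x y : selfAdjoint A, (x : A) + Complex.I • (y : A) ∈ T →
      (x : A) ∈ T ∧ (y : A) ∈ T := by
    intro x y h
    have hx : star (x : A) = x := x.2
    have hy : star (y : A) = y := y.2
    have h' : (x : A) - Complex.I • (y : A) ∈ T := by
      have h2 : star ((x : A) + Complex.I • (y : A)) ∈ T := star_mem h
      rwa [star_add, star_smul, hx, hy, RCLike.star_def, Complex.conj_I, neg_smul,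
        ← sub_eq_add_neg] at h2
    have h1 := T.smul_mem (r := (1 / 2 : ℂ)) (add_mem h h')
    have h2 := T.smul_mem (r := (-Complex.I / 2 : ℂ)) (sub_mem h h')
    rw [add_add_sub_cancel, ← two_smul ℂ, smul_smul] at h1
    rw [add_sub_sub_cancel, ← two_smul ℂ, smul_smul, smul_smul] at h2
    rw [show (-Complex.I / 2 : ℂ) * 2 * Complex.I = 1 by
      linear_combination -Complex.I_mul_I, one_smul] at h2
    norm_num at h1
    exact ⟨h1, h2⟩
  rcases o with _ | ⟨r, i, j⟩
  · simpa [paramDiag] using hdiag 0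
  · rcases lt_trichotomy i j with h | h | h
    · have := hentry r i j
      rw [paramEntry, if_pos h, paramUpper] at this
      split_ifs at this with h0
      · simpa using this
      · exact (hre _ _ this).1
    · subst h
      simpa [paramEntry] using hentry r i i
    · by_cases h0 : r = 0 ∧ j = 0
      · obtain ⟨rfl, rfl⟩ := h0
        have := hdiag i
        rwa [paramDiag, if_neg h.ne'] at this
      · have := hentry r j i
        rw [paramEntry, if_pos h, paramUpper, if_neg h0] at this
        exact (hre _ _ this).2

/-- Every tuple of self-adjoint matrices with first matrix diagonal and with self-adjoint entries in
the first row of the second matrix is parametrized. -/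
theorem exists_paramTuple_eq
    {a : Fin (q + 2) → selfAdjoint (CStarMatrix (Fin (p + 1)) (Fin (p + 1)) A)}
    {d : Fin (p + 1) → selfAdjoint A}
    (h0 : (a 0 : CStarMatrix (Fin (p + 1)) (Fin (p + 1)) A) = diagHom fun i => (d i : A))
    (h1 : ∀ j ≠ 0, IsSelfAdjoint ((a 1 : CStarMatrix (Fin (p + 1)) (Fin (p + 1)) A) 0 j)) :
    ∃ c, paramTuple c = a ∧ ∀ i, paramDiag c i = d i := by
  let e : Fin (q + 1) → Fin (p + 1) → Fin (p + 1) → A := fun r i j =>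
    (a r.succ : CStarMatrix (Fin (p + 1)) (Fin (p + 1)) A) i j
  have hestar : ∀ r i j, star (e r i j) = e r j i := by
    intro r i j
    have h := (a r.succ).2
    rw [selfAdjoint.mem_iff] at h
    simp only [e]
    rw [← CStarMatrix.star_apply, h]
  -- Slots on and above the diagonal hold real parts, those below hold imaginary parts. The first
  -- column of block `0` would hold the vanishing imaginary parts of the self-adjoint row, so it
  -- stores `d i` for `i ≠ 0`; `d 0` needs the extra slot `none`.
  let c : Option (Fin (q + 1) × Fin (p + 1) × Fin (p + 1)) → selfAdjoint A := fun o =>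
    match o with
    | none => d 0
    | some (r, i, j) => if i ≤ j then realPart (e r i j) else
        if r = 0 ∧ j = 0 then d i else imaginaryPart (e r j i)
  have hcd : ∀ i, paramDiag c i = d i := by
    intro i
    unfold paramDiag
    split_ifs with hi
    · rw [hi]
    · simp [c, hi]
  have hup : ∀ r i j, i < j → paramUpper c r i j = e r i j := by
    intro r i j hij
    unfold paramUpper
    split_ifs with h
    · obtain ⟨rfl, rfl⟩ := h
      simp only [c, if_pos hij.le, smul_zero, add_zero]
      exact IsSelfAdjoint.coe_realPart (h1 j hij.ne')
    · simp only [c, if_pos hij.le, if_neg hij.not_ge, if_neg h]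
      exact realPart_add_I_smul_imaginaryPart _
  refine ⟨c, ?_, hcd⟩
  funext s
  refine Fin.cases ?_ (fun r => ?_) s
  · ext1
    rw [paramTuple_zero, h0]
    simp only [hcd]
  · ext i j
    rw [paramTuple_succ_apply]
    change paramEntry c r i j = e r i j
    unfold paramEntry
    split_ifs with h h'
    · exact hup r i j h
    · rw [hup r j i h', hestar]
    · obtain rfl : i = j := le_antisymm (not_lt.1 h') (not_lt.1 h)
      simp only [c, le_refl, if_true]
      exact IsSelfAdjoint.coe_realPart (hestar r i i)

end Parameters

end CStarRank

/-! ### Reduction of arbitrary tuples to the normal form -/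

namespace CStarRank

open Filter Topology CStarMatrix

variable {A : Type*} [CStarAlgebra A] [PartialOrder A] [StarOrderedRing A] {p q : ℕ}

/-- Generating parameters close to a separated diagonal and a positive first row yield generating
tuples of matrices. -/
theorem paramTuple_mem_genSA
    {c : Option (Fin (q + 1) × Fin (p + 1) × Fin (p + 1)) → selfAdjoint A}
    (hc : (NonUnitalStarAlgebra.adjoin ℂ (Set.range fun o => (c o : A))).topologicalClosure = ⊤)
    {V : Option (Fin (p + 1)) → Set ℝ} (hV : ∀ o, IsOpen (V o)) (h0 : (0 : ℝ) ∈ V none)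
    (hdisj : Pairwise fun o o' => Disjoint (V o) (V o'))
    (hdV : ∀ i, spectrum ℝ (paramDiag c i : A) ⊆ V (some i))
    (hrow : ∀ j ≠ 0, spectrum ℝ (paramEntry c 0 0 j) ⊆ Set.Ioi 0) :
    paramTuple c ∈ genSA (CStarMatrix (Fin (p + 1)) (Fin (p + 1)) A) (q + 2) := by
  set S := generatedSubalgebra fun s =>
    (paramTuple c s : CStarMatrix (Fin (p + 1)) (Fin (p + 1)) A) with hSdef
  have hS : IsClosed (S : Set (CStarMatrix (Fin (p + 1)) (Fin (p + 1)) A)) :=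
    NonUnitalStarSubalgebra.isClosed_topologicalClosure _
  have hmem : ∀ s, (paramTuple c s : CStarMatrix (Fin (p + 1)) (Fin (p + 1)) A) ∈ S := fun s =>
    NonUnitalStarSubalgebra.le_topologicalClosure _
      (NonUnitalStarAlgebra.subset_adjoin ℂ _ ⟨s, rfl⟩)
  have hdiag : ∀ i, unitMat i i (1 : A) ∈ S := by
    intro i
    rw [← diagHom_single]
    exact map_single_mem continuous_diagHom (fun i => (paramDiag c i).2) hV h0 hdV hdisj
      (hmem 0) i
  refine eq_top_of_entries (hS := hS) 0 hdiag (fun j hj => ⟨_, hmem (Fin.succ 0), ?_, ?_⟩) ?_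
  · rw [paramTuple_succ_apply]
    exact (spectrum.zero_notMem_iff ℝ).1 fun h => lt_irrefl (0 : ℝ) (hrow j hj h)
  · rw [paramTuple_succ_apply]
    have hpos : 0 < j := Fin.pos_of_ne_zero hj
    have hsa : IsSelfAdjoint (paramEntry c 0 0 j) := by
      rw [paramEntry, if_pos hpos, paramUpper, if_pos ⟨rfl, rfl⟩, smul_zero, add_zero]
      exact (c _).2
    exact (StarOrderedRing.nonneg_iff_spectrum_nonneg (R := ℝ) _ (ha := hsa)).2 fun t ht => le_of_lt (hrow j hj ht)
  · intro T hT h1 hTe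
    have hdT : ∀ i, (paramDiag c i : A) ∈ T := by
      intro i
      have := hTe _ (hmem 0) i i
      rwa [paramTuple_zero, diagHom_apply_eq] at this
    have heT : ∀ r i j, paramEntry c r i j ∈ T := by
      intro r i j
      have := hTe _ (hmem r.succ) i j
      rwa [paramTuple_succ_apply] at this
    rw [← top_le_iff, ← hc]
    refine NonUnitalStarSubalgebra.topologicalClosure_minimal _
      (NonUnitalStarAlgebra.adjoin_le ?_) hT
    rintro _ ⟨o, rfl⟩
    exact param_mem hdT heT o

/-- The tuple comes from parameters `c`. Generating parameters exist arbitrarily close to `c`, and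
upper hemicontinuity of the spectrum preserves the separation and positivity that make their tuple
generate. -/
theorem mem_closure_genSA_of_positive_row (hgr : generatorRank A ≤ ((q + 1) * (p + 1) ^ 2 : ℕ))
    {a : Fin (q + 2) → selfAdjoint (CStarMatrix (Fin (p + 1)) (Fin (p + 1)) A)}
    {d : Fin (p + 1) → selfAdjoint A} (hd : SeparatedSpectra d)
    (h0 : (a 0 : CStarMatrix (Fin (p + 1)) (Fin (p + 1)) A) = diagHom fun i => (d i : A))
    (hsa : ∀ j ≠ 0, IsSelfAdjoint ((a 1 : CStarMatrix (Fin (p + 1)) (Fin (p + 1)) A) 0 j))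
    (hpos : ∀ j ≠ 0,
      spectrum ℝ ((a 1 : CStarMatrix (Fin (p + 1)) (Fin (p + 1)) A) 0 j) ⊆ Set.Ioi 0) :
    a ∈ closure (genSA (CStarMatrix (Fin (p + 1)) (Fin (p + 1)) A) (q + 2)) := by
  obtain ⟨c, rfl, hcd⟩ := exists_paramTuple_eq h0 hsa
  -- The index `none` stands for `{0}`, which must also be separated from the spectra.
  let K : Option (Fin (p + 1)) → Set ℝ := fun o => o.elim {0} fun i => spectrum ℝ (d i : A)
  obtain ⟨V, hV, hKV, hdisj⟩ := exists_open_pairwise_disjoint (K := K)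
    (by
      rintro (_ | i)
      · exact isCompact_singleton
      · exact spectrum.isCompact (𝕜 := ℝ) (d i : A))
    (by
      rintro (_ | i) (_ | j) hij
      · exact absurd rfl hij
      · exact Set.disjoint_singleton_left.2 (hd.1 j)
      · exact Set.disjoint_singleton_right.2 (hd.1 i)
      · exact hd.2 fun h => hij (congrArg some h))
  have hcard : (q + 1) * (p + 1) ^ 2 + 1 ≤
      Fintype.card (Option (Fin (q + 1) × Fin (p + 1) × Fin (p + 1))) := by
    simp [sq]
  refine mem_closure_of_continuousAt continuous_paramTuple.continuousAt
    (dense_generating _ hcard hgr c) ?_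
  have hev1 : ∀ᶠ c' in 𝓝 c, ∀ i, spectrum ℝ (paramDiag c' i : A) ⊆ V (some i) := by
    refine eventually_all.2 fun i => ?_
    have hi : spectrum ℝ (paramDiag c i : A) ⊆ V (some i) := by
      rw [hcd]; exact hKV (some i)
    exact (continuous_paramDiag i).continuousAt.eventually (eventually_spectrum_subset (hV _) hi)
  have hev2 : ∀ᶠ c' in 𝓝 c, ∀ j, j ≠ 0 → spectrum ℝ (paramEntry c' 0 0 j) ⊆ Set.Ioi 0 := by
    refine eventually_all.2 fun j => ?_
    by_cases hj : j = 0
    · exact Eventually.of_forall fun _ h => absurd hj h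
    have hcont : Continuous fun c' : Option (Fin (q + 1) × Fin (p + 1) × Fin (p + 1)) →
        selfAdjoint A => paramEntry c' 0 0 j := by
      simp only [paramEntry, if_pos (Fin.pos_of_ne_zero hj)]
      exact continuous_paramUpper 0 0 j
    have := hcont.continuousAt.eventually
      (eventually_spectrum_subset isOpen_Ioi (hpos j hj))
    exact this.mono fun _ h _ => h
  filter_upwards [hev1, hev2] with c' hc1 hc2 hc'
  exact paramTuple_mem_genSA hc' hV (hKV none rfl) hdisj hc1 hc2

/-- Conjugation by a diagonal unitary keeps the first matrix diagonal with the same entry spectra,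
and rotates each invertible row entry to a positive one. -/
theorem mem_closure_genSA_of_isUnit_row (hgr : generatorRank A ≤ ((q + 1) * (p + 1) ^ 2 : ℕ))
    {a : Fin (q + 2) → selfAdjoint (CStarMatrix (Fin (p + 1)) (Fin (p + 1)) A)}
    {d : Fin (p + 1) → selfAdjoint A} (hd : SeparatedSpectra d)
    (h0 : (a 0 : CStarMatrix (Fin (p + 1)) (Fin (p + 1)) A) = diagHom fun i => (d i : A))
    (hu : ∀ j ≠ 0, IsUnit ((a 1 : CStarMatrix (Fin (p + 1)) (Fin (p + 1)) A) 0 j)) :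
    a ∈ closure (genSA (CStarMatrix (Fin (p + 1)) (Fin (p + 1)) A) (q + 2)) := by
  -- Taking `v 0 = 1` ensures that the first row is only multiplied on the right.
  have hv : ∀ j : Fin (p + 1), ∃ v ∈ unitary A, (j = 0 → v = 1) ∧ (j ≠ 0 →
      IsSelfAdjoint ((a 1 : CStarMatrix (Fin (p + 1)) (Fin (p + 1)) A) 0 j * v) ∧
      spectrum ℝ ((a 1 : CStarMatrix (Fin (p + 1)) (Fin (p + 1)) A) 0 j * v) ⊆ Set.Ioi 0) := by
    intro j
    by_cases hj : j = 0
    · exact ⟨1, one_mem _, fun _ => rfl, fun h => absurd hj h⟩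
    · obtain ⟨v, hv, hv'⟩ := exists_unitary_spectrum_mul_subset (hu j hj)
      exact ⟨v, hv, fun h => absurd h hj, fun _ => hv'⟩
  choose v hvu hv0 hv1 using hv
  set W : CStarMatrix (Fin (p + 1)) (Fin (p + 1)) A := diagHom v with hW
  have hvpi : v ∈ unitary (Fin (p + 1) → A) :=
    ⟨funext fun i => (hvu i).1, funext fun i => (hvu i).2⟩
  have hWu : W ∈ unitary (CStarMatrix (Fin (p + 1)) (Fin (p + 1)) A) :=
    Unitary.map_mem diagHom hvpi
  have hWs : star W = diagHom (star v) := (map_star diagHom v).symm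
  set b := fun s => conjSA (star W) (a s) with hb
  have hab : a = fun s => conjSA W (b s) := by
    funext s
    exact (conjSA_conjSA_star hWu (a s)).symm
  have hbe : ∀ s, (b s : CStarMatrix (Fin (p + 1)) (Fin (p + 1)) A) =
      diagHom (star v) * a s * diagHom v := fun s => by
    rw [← hWs, ← hW]
    change star W * _ * star (star W) = _
    rw [star_star]
  have hb1 : ∀ j, (b 1 : CStarMatrix (Fin (p + 1)) (Fin (p + 1)) A) 0 j =
      (a 1 : CStarMatrix (Fin (p + 1)) (Fin (p + 1)) A) 0 j * v j := by
    intro j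
    rw [hbe, mul_diagHom_apply, diagHom_mul_apply, Pi.star_apply, hv0 0 rfl, star_one, one_mul]
  let d' : Fin (p + 1) → selfAdjoint A := fun i => conjSA (star (v i)) (d i)
  have hspec : ∀ i, spectrum ℝ (d' i : A) = spectrum ℝ (d i : A) := by
    intro i
    have := Unitary.spectrum_star_left_conjugate (R := ℝ) (a := (d i : A)) (U := ⟨v i, hvu i⟩)
    rw [← this]
    change spectrum ℝ (star (v i) * d i * star (star (v i))) = _
    rw [star_star]
  rw [hab]
  refine conjSA_mem_closure_genSA hWu
    (mem_closure_genSA_of_positive_row hgr (d := d') ?_ ?_ ?_ ?_)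
  · refine ⟨fun i => ?_, fun i j hij => ?_⟩
    · rw [hspec]; exact hd.1 i
    · change Disjoint (spectrum ℝ (d' i : A)) (spectrum ℝ (d' j : A))
      rw [hspec, hspec]; exact hd.2 hij
  · rw [hbe, h0, ← map_mul, ← map_mul]
    congr 1
    funext i
    change _ = star (v i) * d i * star (star (v i))
    rw [star_star]
    rfl
  · intro j hj
    rw [hb1]; exact (hv1 j hj).1
  · intro j hj
    rw [hb1]; exact (hv1 j hj).2

theorem mem_closure_genSA_of_separatedSpectra (hu : Dense {x : A | IsUnit x})
    (hgr : generatorRank A ≤ ((q + 1) * (p + 1) ^ 2 : ℕ))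
    {a : Fin (q + 2) → selfAdjoint (CStarMatrix (Fin (p + 1)) (Fin (p + 1)) A)}
    {d : Fin (p + 1) → selfAdjoint A} (hd : SeparatedSpectra d)
    (h0 : (a 0 : CStarMatrix (Fin (p + 1)) (Fin (p + 1)) A) = diagHom fun i => (d i : A)) :
    a ∈ closure (genSA (CStarMatrix (Fin (p + 1)) (Fin (p + 1)) A) (q + 2)) := by
  set e : Fin (p + 1) → Fin (p + 1) → A :=
    fun i j => (a 1 : CStarMatrix (Fin (p + 1)) (Fin (p + 1)) A) i j with he
  have hestar : ∀ i j, star (e i j) = e j i := by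
    intro i j
    have h := (a 1).2
    rw [selfAdjoint.mem_iff] at h
    simp only [he]
    rw [← CStarMatrix.star_apply, h]
  -- The off-diagonal first row is replaced by `x` and the first column by its adjoint, so the
  -- matrix stays self-adjoint.
  let g : (Fin (p + 1) → A) → Fin (p + 1) → Fin (p + 1) → A := fun x i j =>
    if i = 0 then (if j = 0 then e 0 0 else x j) else if j = 0 then star (x i) else e i j
  have hgstar : ∀ x i j, star (g x i j) = g x j i := by
    intro x i j
    simp only [g]
    split_ifs <;> simp [hestar]
  let G : (Fin (p + 1) → A) → selfAdjoint (CStarMatrix (Fin (p + 1)) (Fin (p + 1)) A) := fun x =>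
    ⟨ofMatrix (g x), by
      rw [selfAdjoint.mem_iff]
      ext i j
      rw [CStarMatrix.star_apply]
      exact hgstar x j i⟩
  have hGc : Continuous G := by
    refine continuous_induced_rng.2 (continuous_matrix_mk fun i j => ?_)
    change Continuous fun x => g x i j
    simp only [g]
    split_ifs <;> fun_prop
  have hGe : G (e 0) = a 1 := by
    ext i j
    change g (e 0) i j = e i j
    simp only [g]
    split_ifs with h1 h2 h2
    · rw [h1, h2]
    · rw [h1]
    · rw [hestar, h2]
    · rfl
  have ha : Function.update a 1 (G (e 0)) = a := by rw [hGe, Function.update_eq_self]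
  rw [← ha, ← closure_closure]
  have hdense : Dense (Set.univ.pi fun _ : Fin (p + 1) => {x : A | IsUnit x}) :=
    dense_pi Set.univ fun _ _ => hu
  refine map_mem_closure (f := fun x => Function.update a 1 (G x))
    (continuous_const.update 1 hGc) (hdense (e 0)) fun x hx => ?_
  refine mem_closure_genSA_of_isUnit_row hgr hd ?_ fun j hj => ?_
  · beta_reduce
    rw [Function.update_of_ne Fin.zero_ne_one, h0]
  · beta_reduce
    rw [Function.update_self]
    change IsUnit (g x 0 j)
    simp only [g, if_true, if_neg hj]
    exact hx j trivial

/-- Generation is invariant under simultaneous unitary conjugation, so the unitary that nearly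
diagonalizes the first matrix is applied to the whole tuple and undone at the end; only the first
entry has changed. -/
theorem dense_genSA_matrix (hrr : Dense {x : selfAdjoint A | IsUnit (x : A)})
    (hu : Dense {x : A | IsUnit x}) (hgr : generatorRank A ≤ ((q + 1) * (p + 1) ^ 2 : ℕ)) :
    Dense (genSA (CStarMatrix (Fin (p + 1)) (Fin (p + 1)) A) (q + 2)) := by
  have hdiagsa : ∀ d : Fin (p + 1) → selfAdjoint A,
      (diagHom fun i => (d i : A)) ∈ selfAdjoint (CStarMatrix (Fin (p + 1)) (Fin (p + 1)) A) := by
    intro d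
    rw [selfAdjoint.mem_iff, ← map_star]
    congr 1
    funext i
    exact (d i).2
  let D : (Fin (p + 1) → selfAdjoint A) →
      selfAdjoint (CStarMatrix (Fin (p + 1)) (Fin (p + 1)) A) := fun d => ⟨_, hdiagsa d⟩
  have hDc : Continuous D :=
    continuous_induced_rng.2 (continuous_diagHom.comp
      (continuous_pi fun i => continuous_subtype_val.comp (continuous_apply i)))
  have hDiag : ∀ (a : Fin (q + 2) → selfAdjoint (CStarMatrix (Fin (p + 1)) (Fin (p + 1)) A))
      (d : Fin (p + 1) → selfAdjoint A), Function.update a 0 (D d) ∈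
        closure (genSA (CStarMatrix (Fin (p + 1)) (Fin (p + 1)) A) (q + 2)) := by
    intro a d
    rw [← closure_closure]
    refine map_mem_closure (f := fun d => Function.update a 0 (D d))
      (continuous_const.update 0 hDc) (dense_separatedSpectra hrr (p + 1) d) fun d' hd' => ?_
    exact mem_closure_genSA_of_separatedSpectra hu hgr hd'
      (by beta_reduce; rw [Function.update_self])
  intro a
  rw [← closure_closure]
  refine Metric.mem_closure_iff.2 fun ε hε => ?_
  obtain ⟨u, huu, d, hlt⟩ := exists_unitary_norm_conj_sub_diag_lt hrr (a 0).2 hε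
  refine ⟨_, conjSA_mem_closure_genSA huu (hDiag (fun s => conjSA (star u) (a s)) d), ?_⟩
  refine (dist_pi_lt_iff hε).2 fun s => ?_
  rcases eq_or_ne s 0 with rfl | hs
  · rw [Function.update_self, Subtype.dist_eq, dist_eq_norm]
    nth_rw 1 [← conjSA_conjSA_star huu (a 0)]
    change ‖u * (star u * a 0 * star (star u)) * star u - u * (diagHom fun i => (d i : A)) *
      star u‖ < ε
    rw [← sub_mul, ← mul_sub, star_star]
    have := norm_star_mul_mul_unitary (Unitary.star_mem huu)
      (star u * a 0 * u - diagHom fun i => (d i : A))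
    rw [star_star] at this
    rwa [this]
  · rw [Function.update_of_ne hs, conjSA_conjSA_star huu, dist_self]
    exact hε

theorem generatorRank_matrix_le (hrr : realRank A = 0) (hsr : stableRank A = 1) {n l : ℕ}
    (hn : 1 ≤ n) (hl : 1 ≤ l) (hgr : generatorRank A ≤ (l * n ^ 2 : ℕ)) :
    generatorRank (CStarMatrix (Fin n) (Fin n) A) ≤ l := by
  obtain ⟨p, rfl⟩ := Nat.exists_eq_add_of_le' hn
  obtain ⟨q, rfl⟩ := Nat.exists_eq_add_of_le' hl
  exact iInf₂_le (q + 1)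
    (dense_genSA_matrix (dense_isUnit_selfAdjoint hrr) (dense_isUnit hsr) hgr)

end CStarRank

theorem mainTheorem11 {A : Type*} [CStarAlgebra A] [PartialOrder A] [StarOrderedRing A]
    (hrr : CStarRank.realRank A = 0) (hsr : CStarRank.stableRank A = 1)
    (hgr : 1 ≤ CStarRank.generatorRank A) (n : ℕ) (hn : 1 ≤ n) :
    CStarRank.generatorRank (CStarMatrix (Fin n) (Fin n) A) ≤
        ⌈(CStarRank.generatorRank A : ℝ≥0∞) / (n : ℝ≥0∞) ^ 2⌉ₑ ∧
      (CStarRank.generatorRank A ≤ (n : ℕ∞) ^ 2 →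
        CStarRank.generatorRank (CStarMatrix (Fin n) (Fin n) A) ≤ 1) := by
  constructor
  · have hn0 : (n : ℝ≥0∞) ^ 2 ≠ 0 := by positivity
    have hntop : (n : ℝ≥0∞) ^ 2 ≠ ∞ := ENNReal.pow_ne_top (ENNReal.natCast_ne_top n)
    have hle : (CStarRank.generatorRank A : ℝ≥0∞) / (n : ℝ≥0∞) ^ 2 ≤
        (⌈(CStarRank.generatorRank A : ℝ≥0∞) / (n : ℝ≥0∞) ^ 2⌉ₑ : ℝ≥0∞) := ENat.le_ceil_self
    generalize hk : ⌈(CStarRank.generatorRank A : ℝ≥0∞) / (n : ℝ≥0∞) ^ 2⌉ₑ = k at hle ⊢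
    induction k using ENat.recTopCoe with
    | top => exact le_top
    | coe l =>
      rw [ENNReal.div_le_iff hn0 hntop] at hle
      have hle' : CStarRank.generatorRank A ≤ ((l * n ^ 2 : ℕ) : ℕ∞) := by
        rw [← ENat.toENNReal_le]
        simpa using hle
      refine CStarRank.generatorRank_matrix_le hrr hsr hn ?_ hle'
      -- The normal form needs a second matrix; `l = 0` would force generator rank zero, against
      -- `hgr`.
      rcases Nat.eq_zero_or_pos l with rfl | h
      · rw [zero_mul] at hle'
        exact absurd (hgr.trans hle') (by simp)
      · exact h
  · intro h
    have := CStarRank.generatorRank_matrix_le hrr hsr hn le_rfl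
      (by rw [one_mul]; exact_mod_cast h)
    exact_mod_cast this
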